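/- For positive integers $m,n$, let $\mathcal X$ be the set of $m\times m$ $0$-$1$ matrices all of whose row sums and column sums equal $1$, and let $\mathcal Y$ be the set of such $n\times n$ matrices. An $m\times m\times n\times n$ cost array $Q=(q_{ijk\ell})$ of the bilinear assignment problem is called *linearizable* if there are a real $m\times m$ matrix $A=(a_{ij})$ and a real $n\times n$ matrix $B=(b_{k\ell})$ such that $$\sum_{i=1}^m\sum_{j=1}^m\sum_{k=1}^n\sum_{\ell=1}^n q_{ijk\ell}\,x_{ij}\,y_{k\ell}=\sum_{i=1}^m\sum_{j=1}^m a_{ij}x_{ij}+\sum_{k=1}^n\sum_{\ell=1}^n b_{k\ell}y_{k\ell}\qquad\text{for all } x\in\mathcal X,\ y\in\mathcal Y;$$ such a pair $(A,B)$ is called a *linearization* of $Q$. Then there is a polynomial-time algorithm which, given positive integers $m,n$ and an $m\times m\times n\times n$ cost array $Q$ with rational entries, decides whether $Q$ is linearizable and, if it is, outputs a linearization $(A,B)$ of $Q$ with rational entries. Here polynomial time means: by a Turing machine, in a number of steps bounded by a polynomial in the length of the input, where every rational number (in the input and in the output) is written as a fraction $p/q$ of integers with $q>0$, not necessarily in lowest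 terms, in binary. -/

import Mathlib

namespace BAP

/-! ### Assignments and linearizations -/

/-- An `m × m × n × n` array with entries in `R`. -/
abbrev CostArray (m n : ℕ) (R : Type) : Type :=
  Fin m → Fin m → Fin n → Fin n → R

/-- `x` is a 0-1 matrix all of whose row sums and column sums are equal to `1`. -/
structure IsAssignment {m : ℕ} (x : Matrix (Fin m) (Fin m) ℝ) : Prop where
  zero_or_one : ∀ i j, x i j = 0 ∨ x i j = 1
  row_sum : ∀ i, ∑ j, x i j = 1
  col_sum : ∀ j, ∑ i, x i j = 1

/-- The matrices `A` and `B` are a linearization of the cost array `Q`. -/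
def IsLinearization {m n : ℕ} (Q : CostArray m n ℝ)
    (A : Matrix (Fin m) (Fin m) ℝ) (B : Matrix (Fin n) (Fin n) ℝ) : Prop :=
  ∀ (x : Matrix (Fin m) (Fin m) ℝ) (y : Matrix (Fin n) (Fin n) ℝ),
    IsAssignment x → IsAssignment y →
      ∑ i, ∑ j, ∑ k, ∑ l, Q i j k l * x i j * y k l
        = ∑ i, ∑ j, A i j * x i j + ∑ k, ∑ l, B k l * y k l

/-- The cost array `Q` is linearizable. -/
def Linearizable {m n : ℕ} (Q : CostArray m n ℝ) : Prop :=
  ∃ (A : Matrix (Fin m) (Fin m) ℝ) (B : Matrix (Fin n) (Fin n) ℝ), IsLinearization Q A B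

/-! ### Rational data and their binary encoding -/

/-- A fraction `num / den` with positive denominator, not necessarily in lowest terms. -/
@[ext]
structure Fraction where
  num : ℤ
  den : ℕ
  den_pos : 0 < den

/-- The number that a fraction denotes. -/
noncomputable def Fraction.toReal (q : Fraction) : ℝ := (q.num : ℝ) / (q.den : ℝ)

/-- An input: the two sizes and an `m × m × n × n` array of rational numbers. -/
structure Input where
  m : ℕ
  n : ℕ
  m_pos : 0 < m
  n_pos : 0 < n
  entry : CostArray m n Fraction

/-- The cost array of an input, as an array of real numbers. -/
noncomputable def Input.cost (I : Input) : CostArray I.m I.n ℝ :=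
  fun i j k l => (I.entry i j k l).toReal

/-- An answer for sizes `m` and `n`: either "no", or a pair of rational matrices. -/
abbrev Answer (m n : ℕ) : Type :=
  Option (Matrix (Fin m) (Fin m) Fraction × Matrix (Fin n) (Fin n) Fraction)

/-- The alphabet in which inputs and answers are written. -/
inductive Sym where
  | zero | one | minus | slash | sep | yes | no
  deriving DecidableEq

instance : Fintype Sym where
  elems := {Sym.zero, Sym.one, Sym.minus, Sym.slash, Sym.sep, Sym.yes, Sym.no}
  complete s := by cases s <;> decide

/-- The binary digits of a natural number, least significant digit first, and without a
superfluous digit `0` at the most significant end (the number `0` is the empty word). -/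
def encodeNat (a : ℕ) : List Sym :=
  a.bits.map fun b => if b then Sym.one else Sym.zero

/-- An optional minus sign, followed by the binary digits of the absolute value. -/
def encodeInt (z : ℤ) : List Sym :=
  (if z < 0 then [Sym.minus] else []) ++ encodeNat z.natAbs

/-- A fraction: numerator, slash, denominator, separator. -/
def encodeFraction (q : Fraction) : List Sym :=
  encodeInt q.num ++ Sym.slash :: (encodeNat q.den ++ [Sym.sep])

/-- A matrix: its entries row by row. -/
def encodeMatrix {s : ℕ} (A : Matrix (Fin s) (Fin s) Fraction) : List Sym :=
  (List.finRange s).flatMap fun i => (List.finRange s).flatMap fun j => encodeFraction (A i j)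

/-- A cost array: its entries in lexicographic order of the four indices. -/
def encodeCostArray {m n : ℕ} (Q : CostArray m n Fraction) : List Sym :=
  (List.finRange m).flatMap fun i => (List.finRange m).flatMap fun j =>
    (List.finRange n).flatMap fun k => (List.finRange n).flatMap fun l =>
      encodeFraction (Q i j k l)

/-- An input: the sizes in unary, followed by the `m² n²` entries. As `m` and `n` are positive,
the entries alone have more than `m² n²` symbols, so that writing the sizes in unary rather than
in binary changes the length of the input at most by a constant factor. -/
def encodeInput (I : Input) : List Sym :=
  List.replicate I.m Sym.one ++ Sym.sep :: (List.replicate I.n Sym.one ++ Sym.sep ::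
    encodeCostArray I.entry)

/-- An answer: the word `no`, or `yes` followed by the two matrices. -/
def encodeAnswer {m n : ℕ} : Answer m n → List Sym
  | none => [Sym.no]
  | some (A, B) => Sym.yes :: (encodeMatrix A ++ encodeMatrix B)

/-! ### The encodings are unambiguous -/

theorem encodeNat_injective : Function.Injective encodeNat := by
  intro a b h
  have hinj : Function.Injective (fun b : Bool => if b then Sym.one else Sym.zero) := by
    decide
  have h2 := hinj.list_map h
  have := congrArg (fun l : List Bool => l.foldr Nat.bit 0) h2
  have key : ∀ c : ℕ, c.bits.foldr Nat.bit 0 = c := by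
    intro c
    induction c using Nat.binaryRec' with
    | zero => simp
    | bit b n hb ih => rw [Nat.bits_append_bit n b hb]; simp [ih]
  simpa [key] using this

theorem mem_encodeNat {a : ℕ} {s : Sym} (h : s ∈ encodeNat a) : s = Sym.zero ∨ s = Sym.one := by
  simp only [encodeNat, List.mem_map] at h
  obtain ⟨b, -, rfl⟩ := h
  cases b <;> simp

theorem mem_encodeInt {z : ℤ} {s : Sym} (h : s ∈ encodeInt z) :
    s = Sym.minus ∨ s = Sym.zero ∨ s = Sym.one := by
  simp only [encodeInt, List.mem_append] at h
  rcases h with h | h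
  · split_ifs at h <;> simp_all
  · exact Or.inr (mem_encodeNat h)

theorem encodeInt_injective : Function.Injective encodeInt := by
  intro a b h
  have hm : ∀ (c : ℕ) (l : List Sym), encodeNat c ≠ Sym.minus :: l := by
    intro c l hc
    have : Sym.minus ∈ encodeNat c := by simp [hc]
    simpa using mem_encodeNat this
  unfold encodeInt at h
  split_ifs at h with ha hb hb
  · have := encodeNat_injective (by simpa using h)
    omega
  · exact absurd h.symm (hm _ _)
  · exact absurd h (hm _ _)
  · have := encodeNat_injective (by simpa using h)
    omega

/-- A word that is cut at the first occurrence of a symbol can be recovered. -/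
theorem append_cons_cancel {c : Sym} : ∀ {u v s t : List Sym}, c ∉ u → c ∉ v →
    u ++ c :: s = v ++ c :: t → u = v ∧ s = t
  | [], [], _, _, _, _, h => by simpa using h
  | [], b :: v, _, _, _, hv, h => by simp_all
  | a :: u, [], _, _, hu, _, h => by simp_all
  | a :: u, b :: v, s, t, hu, hv, h => by
    simp only [List.cons_append, List.cons.injEq] at h
    simp only [List.mem_cons, not_or] at hu hv
    obtain ⟨h1, h2⟩ := append_cons_cancel hu.2 hv.2 h.2
    exact ⟨by rw [h.1, h1], h2⟩

theorem encodeFraction_cancel {p q : Fraction} {s t : List Sym}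
    (h : encodeFraction p ++ s = encodeFraction q ++ t) : p = q ∧ s = t := by
  have hi : ∀ z : ℤ, Sym.slash ∉ encodeInt z := fun z hz => by
    simpa using mem_encodeInt hz
  have hn : ∀ a : ℕ, Sym.sep ∉ encodeNat a := fun a ha => by
    simpa using mem_encodeNat ha
  simp only [encodeFraction, List.append_assoc, List.cons_append, List.nil_append] at h
  obtain ⟨h1, h2⟩ := append_cons_cancel (hi _) (hi _) h
  obtain ⟨h3, h4⟩ := append_cons_cancel (hn _) (hn _) h2
  exact ⟨Fraction.ext (encodeInt_injective h1) (encodeNat_injective h3), h4⟩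

theorem flatMap_cancel {ι β : Type} {c : ι → β → List Sym} {P : ι → β → β → Prop}
    (hc : ∀ (i : ι) (a b : β) (s t : List Sym), c i a ++ s = c i b ++ t → P i a b ∧ s = t)
    {a b : β} : ∀ {l : List ι} {s t : List Sym},
      l.flatMap (fun i => c i a) ++ s = l.flatMap (fun i => c i b) ++ t →
        (∀ i ∈ l, P i a b) ∧ s = t
  | [], _, _, h => by simpa using h
  | i :: l, s, t, h => by
    simp only [List.flatMap_cons, List.append_assoc] at h
    obtain ⟨h1, h2⟩ := hc _ _ _ _ _ h
    obtain ⟨h3, h4⟩ := flatMap_cancel hc h2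
    exact ⟨by simpa using ⟨h1, h3⟩, h4⟩

theorem encodeMatrix_cancel {m : ℕ} {A B : Matrix (Fin m) (Fin m) Fraction} {s t : List Sym}
    (h : encodeMatrix A ++ s = encodeMatrix B ++ t) : A = B ∧ s = t := by
  obtain ⟨h1, h2⟩ := flatMap_cancel
    (c := fun (i : Fin m) (A : Matrix (Fin m) (Fin m) Fraction) =>
      (List.finRange m).flatMap fun j => encodeFraction (A i j))
    (P := fun i A B => ∀ j ∈ List.finRange m, A i j = B i j)
    (fun i A B s t h => flatMap_cancel
      (c := fun (j : Fin m) (A : Matrix (Fin m) (Fin m) Fraction) => encodeFraction (A i j))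
      (P := fun j A B => A i j = B i j) (fun j A B s t h => encodeFraction_cancel h) h) h
  exact ⟨by ext1 i j; exact h1 i (List.mem_finRange i) j (List.mem_finRange j), h2⟩

theorem encodeCostArray_injective {m n : ℕ} :
    Function.Injective (encodeCostArray : CostArray m n Fraction → List Sym) := by
  intro Q R h
  have h' : encodeCostArray Q ++ [] = encodeCostArray R ++ [] := by rw [h]
  obtain ⟨h1, -⟩ := flatMap_cancel
    (c := fun (i : Fin m) (Q : CostArray m n Fraction) => (List.finRange m).flatMap fun j =>
      (List.finRange n).flatMap fun k => (List.finRange n).flatMap fun l =>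
        encodeFraction (Q i j k l))
    (P := fun i Q R => ∀ j ∈ List.finRange m, ∀ k ∈ List.finRange n, ∀ l ∈ List.finRange n,
      Q i j k l = R i j k l)
    (fun i Q R s t h => flatMap_cancel
      (c := fun (j : Fin m) (Q : CostArray m n Fraction) =>
        (List.finRange n).flatMap fun k => (List.finRange n).flatMap fun l =>
          encodeFraction (Q i j k l))
      (P := fun j Q R => ∀ k ∈ List.finRange n, ∀ l ∈ List.finRange n, Q i j k l = R i j k l)
      (fun j Q R s t h => flatMap_cancel
        (c := fun (k : Fin n) (Q : CostArray m n Fraction) =>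
          (List.finRange n).flatMap fun l => encodeFraction (Q i j k l))
        (P := fun k Q R => ∀ l ∈ List.finRange n, Q i j k l = R i j k l)
        (fun k Q R s t h => flatMap_cancel
          (c := fun (l : Fin n) (Q : CostArray m n Fraction) => encodeFraction (Q i j k l))
          (P := fun l Q R => Q i j k l = R i j k l)
          (fun l Q R s t h => encodeFraction_cancel h) h) h) h) h'
  funext i j k l
  exact h1 i (List.mem_finRange i) j (List.mem_finRange j) k (List.mem_finRange k) l
    (List.mem_finRange l)

/-- Different inputs have different codes. -/
theorem encodeInput_injective : Function.Injective encodeInput := by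
  rintro ⟨m, n, hm, hn, Q⟩ ⟨m', n', hm', hn', Q'⟩ h
  have hr : ∀ a : ℕ, Sym.sep ∉ List.replicate a Sym.one := fun a ha => by
    simpa using List.eq_of_mem_replicate ha
  obtain ⟨h1, h2⟩ := append_cons_cancel (hr _) (hr _) h
  obtain ⟨h3, h4⟩ := append_cons_cancel (hr _) (hr _) h2
  have e1 : m = m' := by simpa using congrArg List.length h1
  have e2 : n = n' := by simpa using congrArg List.length h3
  subst e1 e2
  cases encodeCostArray_injective h4
  rfl

/-- For given sizes, different answers have different codes. -/
theorem encodeAnswer_injective {m n : ℕ} :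
    Function.Injective (encodeAnswer : Answer m n → List Sym) := by
  rintro (_ | ⟨A, B⟩) (_ | ⟨A', B'⟩) h
  · rfl
  · simp [encodeAnswer] at h
  · simp [encodeAnswer] at h
  · simp only [encodeAnswer, List.cons.injEq, true_and] at h
    obtain ⟨h1, h2⟩ := encodeMatrix_cancel h
    have h2' : encodeMatrix B ++ [] = encodeMatrix B' ++ [] := by rw [h2]
    rw [h1, (encodeMatrix_cancel h2').1]

end BAP

/-! Take the first index as base point in both assignment problems. For a single cost matrix `c`,
call `c i j + c z z - c z j - c i z` its alternating sum. If all alternating sums of `c` vanish,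
then `c` is a row term plus a column term, and all assignments have the same cost. Conversely, each
alternating sum is the difference of the costs of two assignments. Applying this in both pairs of
indices gives the criterion: `Q` is linearizable if and only if all its double alternating sums
(`deltaDelta`, sixteen entries each) vanish. Necessity holds because a function `a(x) + b(y)` has
zero mixed second differences (`Linearizable.deltaDelta_eq_zero`). For sufficiency, write `Q(x, y)`
for the bilinear cost. Vanishing of the sums yields `Q(x, y) = Q(x, id) + Q(id, y) - Q(id, id)`, and
the right-hand side is given by the explicit matrices `A i j = ∑ k, Q i j k k` and `B k l = ∑ i, (Q
i i k l - Q i i k k)` (`isLinearization_of_deltaDelta_eq_zero`). The algorithm tests about `m² n²`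
sums and writes down these matrices. Fractions are never reduced; this is harmless, since `|num| +
den` is submultiplicative under addition of fractions, so that bit lengths at most add up
(`PolyTime.fraction_sum`). The remaining work is to obtain a Turing machine. Structured programs on
four stacks are compiled to `TM2` machines with exact step counts (`Run.iterate_step`). Data are
binary trees in prefix notation, which is self-delimiting, so a value can be moved, copied or
discarded whatever lies below it. The class `PolyTime` of functions computed by such programs is
closed under composition, pairing, case distinction and folds whose intermediate values stay of
polynomial size. Arithmetic, parsing, printing and the algorithm itself are then assembled from
these closure properties, and `PolyTime.tm2ComputableInPolyTime` turns the result into a machine on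
words. -/

namespace BAP

/-! ### Structured stack programs and their translation to `TM2` machines -/

/-- The four stacks of the machine. -/
inductive Stk where
  | main | left | right | count
  deriving DecidableEq

instance : Fintype Stk where
  elems := {Stk.main, Stk.left, Stk.right, Stk.count}
  complete s := by cases s <;> decide

/-- Structured programs on stacks of symbols. -/
inductive Cmd where
  /-- push a symbol -/
  | push (k : Stk) (s : Sym)
  /-- discard the top symbol -/
  | drop (k : Stk)
  /-- pop a symbol and push it on another stack -/
  | move (k j : Stk)
  /-- pop a symbol and push it on two stacks -/
  | copy (k j j' : Stk)
  /-- run two programs in succession -/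
  | seq (a b : Cmd)
  /-- branch on the top symbol -/
  | ite (k : Stk) (p : Option Sym → Bool) (a b : Cmd)
  /-- repeat as long as the top symbol satisfies a condition -/
  | loop (k : Stk) (p : Option Sym → Bool) (a : Cmd)

/-- Contents of the stacks. -/
abbrev Store : Type := Stk → List Sym

/-- Put a symbol on a stack. -/
def Store.cons (S : Store) (k : Stk) (s : Sym) : Store := Function.update S k (s :: S k)

/-- Remove the top symbol of a stack. -/
def Store.tail (S : Store) (k : Stk) : Store := Function.update S k (S k).tail

/-- `Run c S t S'`: the program `c` leads from the stacks `S` to the stacks `S'` in `t` steps. -/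
inductive Run : Cmd → Store → ℕ → Store → Prop
  | push {k s S} : Run (.push k s) S 1 (S.cons k s)
  | drop {k S} : Run (.drop k) S 1 (S.tail k)
  | move {k j S} {s : Sym} (h : (S k).head? = some s) : Run (.move k j) S 1 ((S.tail k).cons j s)
  | copy {k j j' S} {s : Sym} (h : (S k).head? = some s) :
      Run (.copy k j j') S 1 (((S.tail k).cons j s).cons j' s)
  | seq {a b S S' S'' t t'} : Run a S t S' → Run b S' t' S'' → Run (.seq a b) S (t' + t) S''
  | ite_true {k p a b S t S'} : p (S k).head? = true → Run a S t S' →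
      Run (.ite k p a b) S (t + 1) S'
  | ite_false {k p a b S t S'} : p (S k).head? = false → Run b S t S' →
      Run (.ite k p a b) S (t + 1) S'
  | loop_done {k p a S} : p (S k).head? = false → Run (.loop k p a) S 1 S
  | loop_step {k p a S S' S'' t t'} : p (S k).head? = true → Run a S t S' →
      Run (.loop k p a) S' t' S'' → Run (.loop k p a) S (t' + t + 1) S''

namespace Cmd

/-- The labels of the machine for a program. -/
def Lab : Cmd → Type
  | push _ _ | drop _ | move _ _ | copy _ _ _ => Unit
  | seq a b => a.Lab ⊕ b.Lab
  | ite _ _ a b => Option (a.Lab ⊕ b.Lab)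
  | loop _ _ a => Option a.Lab

instance labFintype : (c : Cmd) → Fintype c.Lab
  | push _ _ | drop _ | move _ _ | copy _ _ _ => inferInstanceAs (Fintype Unit)
  | seq a b =>
    have := labFintype a
    have := labFintype b
    inferInstanceAs (Fintype (a.Lab ⊕ b.Lab))
  | ite _ _ a b =>
    have := labFintype a
    have := labFintype b
    inferInstanceAs (Fintype (Option (a.Lab ⊕ b.Lab)))
  | loop _ _ a =>
    have := labFintype a
    inferInstanceAs (Fintype (Option a.Lab))

/-- The label at which a program starts. -/
def entry : (c : Cmd) → c.Lab
  | push _ _ | drop _ | move _ _ | copy _ _ _ => ()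
  | seq a _ => Sum.inl a.entry
  | ite _ _ _ _ => none
  | loop _ _ _ => none

/-- Statements of the machines; the internal state is the symbol read last. -/
abbrev Code (Λ : Type) : Type := Turing.TM2.Stmt (fun _ : Stk => Sym) Λ (Option Sym)

open Turing.TM2 in
/-- Translation of a program, with labels in `Λ`, that continues with the statement `q`. -/
def compile {Λ : Type} : (c : Cmd) → (c.Lab → Λ) → Code Λ → c.Lab → Code Λ
  | push k s, _, q, _ => .push k (fun _ => s) q
  | drop k, _, q, _ => .pop k (fun _ _ => none) q
  | move k j, _, q, _ =>
    .pop k (fun _ o => o) (.push j (fun v => v.getD .zero) (.load (fun _ => none) q))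
  | copy k j j', _, q, _ =>
    .pop k (fun _ o => o) (.push j (fun v => v.getD .zero) (.push j' (fun v => v.getD .zero)
      (.load (fun _ => none) q)))
  | seq a b, e, q, l =>
    Sum.casesOn l (a.compile (fun l => e (.inl l)) (.goto fun _ => e (.inr b.entry)))
      (b.compile (fun l => e (.inr l)) q)
  | ite k p a b, e, q, l =>
    Option.casesOn l
      (.peek k (fun _ o => o) (.branch (fun v => p v)
        (.load (fun _ => none) (.goto fun _ => e (some (.inl a.entry))))
        (.load (fun _ => none) (.goto fun _ => e (some (.inr b.entry))))))
      (fun l => Sum.casesOn l (a.compile (fun l => e (some (.inl l))) q)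
        (b.compile (fun l => e (some (.inr l))) q))
  | loop k p a, e, q, l =>
    Option.casesOn l
      (.peek k (fun _ o => o) (.branch (fun v => p v)
        (.load (fun _ => none) (.goto fun _ => e (some a.entry))) (.load (fun _ => none) q)))
      (a.compile (fun l => e (some l)) (.goto fun _ => e none))

end Cmd

open Turing.TM2 in
/-- The translation of a program does what the program does, in the same number of steps. -/
theorem Run.iterate_step {Λ : Type} {M : Λ → Cmd.Code Λ} {c : Cmd} {S S' : Store} {t : ℕ}
    (h : Run c S t S') : ∀ (e : c.Lab → Λ) (q : Cmd.Code Λ), (∀ l, M (e l) = c.compile e q l) →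
      (flip bind (step M))^[t] (some ⟨some (e c.entry), none, S⟩) = some (stepAux q none S') := by
  induction h with
  | push =>
    intro e q he
    simp [flip, he, Cmd.compile, Store.cons]
  | drop =>
    intro e q he
    simp [flip, he, Cmd.compile, Store.tail]
  -- By `hs` there is a symbol to pop, so the default `.zero` in the compiled code is never pushed.
  -- The compiled command resets the internal state to `none`, which is the state that the next
  -- command expects.
  | move hs =>
    intro e q he
    simp [flip, he, Cmd.compile, Store.tail, Store.cons, hs]
  | copy hs =>
    intro e q he
    simp [flip, he, Cmd.compile, Store.tail, Store.cons, hs]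
  | seq _ _ iha ihb =>
    intro e q he
    -- Since `f^[t' + t] x = f^[t'] (f^[t] x)`, the time `t' + t` puts the first program on the
    -- inside.
    rw [Function.iterate_add_apply]
    have := iha (fun l => e (.inl l)) _ (fun l => he (.inl l))
    erw [this]
    exact ihb (fun l => e (.inr l)) _ (fun l => he (.inr l))
  | ite_true hp _ ih =>
    intro e q he
    rw [Function.iterate_succ_apply]
    have := ih (fun l => e (some (.inl l))) _ (fun l => he (some (.inl l)))
    rw [← this]
    have h0 : M (e none) = _ := he none
    simp [flip, h0, Cmd.compile, Cmd.entry, hp]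
  | ite_false hp _ ih =>
    intro e q he
    rw [Function.iterate_succ_apply]
    have := ih (fun l => e (some (.inr l))) _ (fun l => he (some (.inr l)))
    rw [← this]
    have h0 : M (e none) = _ := he none
    simp [flip, h0, Cmd.compile, Cmd.entry, hp]
  | loop_done hp =>
    intro e q he
    have h0 : M (e none) = _ := he none
    simp [flip, h0, Cmd.compile, Cmd.entry, hp]
  | loop_step hp _ _ iha ihb =>
    intro e q he
    rw [Function.iterate_succ_apply, Function.iterate_add_apply, ← ihb e q he]
    have := iha (fun l => e (some l)) _ (fun l => he (some l))
    -- The body continues with a jump back to the test, so the end of its run is the configuration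
    -- in which the loop is entered again.
    rw [stepAux] at this
    erw [← this]
    have h0 : M (e none) = _ := he none
    simp [flip, h0, Cmd.compile, Cmd.entry, hp]

/-- The machine of a program, with input and output on the stack `left`. -/
def Cmd.machine (c : Cmd) : Turing.FinTM2 where
  K := Stk
  k₀ := .left
  k₁ := .left
  Γ _ := Sym
  Λ := c.Lab
  main := c.entry
  σ := Option Sym
  initialState := none
  Γk₀Fin := inferInstanceAs (Fintype Sym)
  m := c.compile id .halt

/-- The four stacks with given contents. -/
def Store.mk (m l r c : List Sym) : Store
  | .main => m
  | .left => l
  | .right => r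
  | .count => c

/-- The program is compiled with `halt` as its continuation. All stacks except `left` have to be
empty at the end, because a halting configuration of a `TM2` machine contains nothing but the
output. -/
theorem Run.outputsInTime {c : Cmd} {u v : List Sym} {t T : ℕ}
    (h : Run c (.mk [] u [] []) t (.mk [] v [] [])) (hT : t ≤ T) :
    Nonempty (Turing.TM2OutputsInTime c.machine u (some v) T) := by
  have h1 : Turing.initList c.machine u = ⟨some c.entry, none, Store.mk [] u [] []⟩ := by
    unfold Turing.initList
    congr 1
    funext k
    cases k <;> rfl
  have h2 : Turing.haltList c.machine v = ⟨none, none, Store.mk [] v [] []⟩ := by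
    unfold Turing.haltList
    congr 1
    funext k
    cases k <;> rfl
  refine ⟨⟨⟨t, ?_⟩, hT⟩⟩
  change _ = some (Turing.haltList c.machine v)
  rw [h1, h2]
  exact h.iterate_step (M := c.compile id .halt) id .halt fun l => rfl

/-! ### Bounded runs -/

/-- The program `c` leads from `S` to `S'` in at most `T` steps. -/
def Within (c : Cmd) (S : Store) (T : ℕ) (S' : Store) : Prop := ∃ t ≤ T, Run c S t S'

namespace Store

variable (m l r c : List Sym) (s : Sym)

@[simp] theorem mk_main : mk m l r c .main = m := rfl
@[simp] theorem mk_left : mk m l r c .left = l := rfl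
@[simp] theorem mk_right : mk m l r c .right = r := rfl
@[simp] theorem mk_count : mk m l r c .count = c := rfl

@[simp] theorem cons_main : (mk m l r c).cons .main s = mk (s :: m) l r c := by
  funext k; cases k <;> rfl
@[simp] theorem cons_left : (mk m l r c).cons .left s = mk m (s :: l) r c := by
  funext k; cases k <;> rfl
@[simp] theorem cons_right : (mk m l r c).cons .right s = mk m l (s :: r) c := by
  funext k; cases k <;> rfl
@[simp] theorem cons_count : (mk m l r c).cons .count s = mk m l r (s :: c) := by
  funext k; cases k <;> rfl
@[simp] theorem tail_main : (mk m l r c).tail .main = mk m.tail l r c := by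
  funext k; cases k <;> rfl
@[simp] theorem tail_left : (mk m l r c).tail .left = mk m l.tail r c := by
  funext k; cases k <;> rfl
@[simp] theorem tail_right : (mk m l r c).tail .right = mk m l r.tail c := by
  funext k; cases k <;> rfl
@[simp] theorem tail_count : (mk m l r c).tail .count = mk m l r c.tail := by
  funext k; cases k <;> rfl

end Store

namespace Within

variable {a b : Cmd} {S S' S'' : Store} {T T' : ℕ} {k j j' : Stk} {p : Option Sym → Bool} {s : Sym}

theorem mono (h : Within a S T S') (hT : T ≤ T') : Within a S T' S' :=
  let ⟨t, ht, hr⟩ := h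
  ⟨t, ht.trans hT, hr⟩

theorem push : Within (.push k s) S 1 (S.cons k s) := ⟨1, le_rfl, .push⟩

theorem drop : Within (.drop k) S 1 (S.tail k) := ⟨1, le_rfl, .drop⟩

theorem move (h : (S k).head? = some s) : Within (.move k j) S 1 ((S.tail k).cons j s) :=
  ⟨1, le_rfl, .move h⟩

theorem copy (h : (S k).head? = some s) :
    Within (.copy k j j') S 1 (((S.tail k).cons j s).cons j' s) :=
  ⟨1, le_rfl, .copy h⟩

theorem seq (h : Within a S T S') (h' : Within b S' T' S'') :
    Within (.seq a b) S (T + T') S'' :=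
  let ⟨t, ht, hr⟩ := h
  let ⟨t', ht', hr'⟩ := h'
  ⟨t' + t, by omega, .seq hr hr'⟩

theorem ite_true (hp : p (S k).head? = true) (h : Within a S T S') :
    Within (.ite k p a b) S (T + 1) S' :=
  let ⟨t, ht, hr⟩ := h
  ⟨t + 1, by omega, .ite_true hp hr⟩

theorem ite_false (hp : p (S k).head? = false) (h : Within b S T S') :
    Within (.ite k p a b) S (T + 1) S' :=
  let ⟨t, ht, hr⟩ := h
  ⟨t + 1, by omega, .ite_false hp hr⟩

theorem loop_done (hp : p (S k).head? = false) : Within (.loop k p a) S 1 S :=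
  ⟨1, le_rfl, .loop_done hp⟩

theorem loop_step (hp : p (S k).head? = true) (h : Within a S T S')
    (h' : Within (.loop k p a) S' T' S'') : Within (.loop k p a) S (T + T' + 1) S'' :=
  let ⟨t, ht, hr⟩ := h
  let ⟨t', ht', hr'⟩ := h'
  ⟨t' + t + 1, by omega, .loop_step hp hr hr'⟩

end Within

/-! ### Trees as data -/

/-- Binary trees with symbols at the leaves. -/
inductive Tree where
  | leaf (s : Sym)
  | node (x y : Tree)

/-- The word of a tree, in prefix notation. -/
def Tree.word : Tree → List Sym
  | leaf s => [.zero, s]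
  | node x y => .one :: (x.word ++ y.word)

namespace Cmd

/-- Pour one stack onto another one. -/
def pour (k j : Stk) : Cmd := .loop k Option.isSome (.move k j)

/-- Move the tree on top of `main` to another stack, in reverse. -/
def moveTree (k : Stk) : Cmd :=
  .seq (.push .count .one) <| .loop .count Option.isSome <|
    .ite .main (· == some .one) (.seq (.move .main k) (.push .count .one))
      (.seq (.move .main k) (.seq (.move .main k) (.drop .count)))

/-- Discard the tree on top of `main`. -/
def dropTree : Cmd := .seq (moveTree .left) (.loop .left Option.isSome (.drop .left))

/-- Exchange the two trees on top of `main`. -/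
def swap : Cmd :=
  .seq (moveTree .left) <| .seq (moveTree .right) <| .seq (pour .left .main) (pour .right .main)

/-- Duplicate the tree on top of `main`. -/
def dup : Cmd :=
  .seq (moveTree .left) <| .seq (.loop .left Option.isSome (.copy .left .main .right)) <|
    .seq (pour .right .left) (pour .left .main)

/-- Push a word on `main`. -/
def pushWord : List Sym → Cmd
  | [] => .seq (.push .main .one) (.drop .main)
  | s :: w => .seq (pushWord w) (.push .main s)

end Cmd

/-! ### Running times of the operations on stacks and trees -/

namespace Within

open Cmd

theorem pour_left_main (u m r c : List Sym) :
    Within (pour .left .main) (.mk m u r c) (2 * u.length + 1) (.mk (u.reverse ++ m) [] r c) := by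
  induction u generalizing m with
  | nil => exact loop_done rfl
  | cons s u ih =>
    refine (loop_step rfl (move rfl) (by simpa [pour] using ih (s :: m))).mono ?_
    simp only [List.length_cons]; omega

theorem pour_right_main (u m l c : List Sym) :
    Within (pour .right .main) (.mk m l u c) (2 * u.length + 1) (.mk (u.reverse ++ m) l [] c) := by
  induction u generalizing m with
  | nil => exact loop_done rfl
  | cons s u ih =>
    refine (loop_step rfl (move rfl) (by simpa [pour] using ih (s :: m))).mono ?_
    simp only [List.length_cons]; omega

theorem pour_right_left (u m l c : List Sym) :
    Within (pour .right .left) (.mk m l u c) (2 * u.length + 1) (.mk m (u.reverse ++ l) [] c) := by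
  induction u generalizing l with
  | nil => exact loop_done rfl
  | cons s u ih =>
    refine (loop_step rfl (move rfl) (by simpa [pour] using ih (s :: l))).mono ?_
    simp only [List.length_cons]; omega

theorem pour_left_right (u m r c : List Sym) :
    Within (pour .left .right) (.mk m u r c) (2 * u.length + 1) (.mk m [] (u.reverse ++ r) c) := by
  induction u generalizing r with
  | nil => exact loop_done rfl
  | cons s u ih =>
    refine (loop_step rfl (move rfl) (by simpa [pour] using ih (s :: r))).mono ?_
    simp only [List.length_cons]; omega

theorem copy_left (u m r c : List Sym) :
    Within (.loop .left Option.isSome (.copy .left .main .right)) (.mk m u r c)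
      (2 * u.length + 1) (.mk (u.reverse ++ m) [] (u.reverse ++ r) c) := by
  induction u generalizing m r with
  | nil => exact loop_done rfl
  | cons s u ih =>
    refine (loop_step rfl (copy rfl) (by simpa using ih (s :: m) (s :: r))).mono ?_
    simp only [List.length_cons]; omega

theorem clear_left (u m r c : List Sym) :
    Within (.loop .left Option.isSome (.drop .left)) (.mk m u r c)
      (2 * u.length + 1) (.mk m [] r c) := by
  induction u with
  | nil => exact loop_done rfl
  | cons s u ih =>
    refine (loop_step rfl drop (by simpa using ih)).mono ?_
    simp only [List.length_cons]; omega

/-- The stack `count` holds one token for each subtree still to be read. A node exchanges its token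
for two and a leaf uses its token up, so the loop stops exactly at the end of the tree. -/
theorem moveTree_left (x : Tree) (m l r : List Sym) :
    Within (moveTree .left) (.mk (x.word ++ m) l r []) (4 * x.word.length + 2)
      (.mk m (x.word.reverse ++ l) r []) := by
  -- The claim is stated relative to the rest of the loop: whatever the loop does after the subtree
  -- within time `T`, it does from the start of the subtree with four more steps per symbol. In this
  -- form the induction passes through both children of a node. A node costs four steps for one
  -- symbol, a leaf five steps for two.
  have key : ∀ (x : Tree) (m l c : List Sym) (T : ℕ) (S : Store),
      Within (.loop .count Option.isSome
        (.ite .main (· == some .one) (.seq (.move .main .left) (.push .count .one))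
          (.seq (.move .main .left) (.seq (.move .main .left) (.drop .count)))))
        (.mk m (x.word.reverse ++ l) r c) T S →
      Within (.loop .count Option.isSome
        (.ite .main (· == some .one) (.seq (.move .main .left) (.push .count .one))
          (.seq (.move .main .left) (.seq (.move .main .left) (.drop .count)))))
        (.mk (x.word ++ m) l r (.one :: c)) (4 * x.word.length + T) S := by
    intro x
    induction x with
    | leaf s =>
      intro m l c T S h
      refine (loop_step rfl (ite_false rfl (seq (move rfl)
        (seq (move (s := s) (by simp [Tree.word])) drop))) (T' := T) ?_).mono ?_
      · simpa [Tree.word] using h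
      · simp only [Tree.word, List.length_cons, List.length_nil]; omega
    | node x y ihx ihy =>
      intro m l c T S h
      refine (loop_step rfl (ite_true rfl (seq (move (s := .one) rfl) push))
        (T' := 4 * x.word.length + (4 * y.word.length + T)) ?_).mono ?_
      · have := ihx (y.word ++ m) (.one :: l) (.one :: c) (4 * y.word.length + T) S
          (ihy _ _ _ _ _ (by simpa [Tree.word] using h))
        simpa [Tree.word] using this
      · simp only [Tree.word, List.length_cons, List.length_append]; omega
  refine (seq push (T' := 4 * x.word.length + 1) ?_).mono (by omega)
  simpa using key x m l [] 1 _ (loop_done rfl)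

theorem moveTree_right (x : Tree) (m l r : List Sym) :
    Within (moveTree .right) (.mk (x.word ++ m) l r []) (4 * x.word.length + 2)
      (.mk m l (x.word.reverse ++ r) []) := by
  have key : ∀ (x : Tree) (m r c : List Sym) (T : ℕ) (S : Store),
      Within (.loop .count Option.isSome
        (.ite .main (· == some .one) (.seq (.move .main .right) (.push .count .one))
          (.seq (.move .main .right) (.seq (.move .main .right) (.drop .count)))))
        (.mk m l (x.word.reverse ++ r) c) T S →
      Within (.loop .count Option.isSome
        (.ite .main (· == some .one) (.seq (.move .main .right) (.push .count .one))
          (.seq (.move .main .right) (.seq (.move .main .right) (.drop .count)))))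
        (.mk (x.word ++ m) l r (.one :: c)) (4 * x.word.length + T) S := by
    intro x
    induction x with
    | leaf s =>
      intro m r c T S h
      refine (loop_step rfl (ite_false rfl (seq (move rfl)
        (seq (move (s := s) (by simp [Tree.word])) drop))) (T' := T) ?_).mono ?_
      · simpa [Tree.word] using h
      · simp only [Tree.word, List.length_cons, List.length_nil]; omega
    | node x y ihx ihy =>
      intro m r c T S h
      refine (loop_step rfl (ite_true rfl (seq (move (s := .one) rfl) push))
        (T' := 4 * x.word.length + (4 * y.word.length + T)) ?_).mono ?_
      · have := ihx (y.word ++ m) (.one :: r) (.one :: c) (4 * y.word.length + T) S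
          (ihy _ _ _ _ _ (by simpa [Tree.word] using h))
        simpa [Tree.word] using this
      · simp only [Tree.word, List.length_cons, List.length_append]; omega
  refine (seq push (T' := 4 * x.word.length + 1) ?_).mono (by omega)
  simpa using key x m r [] 1 _ (loop_done rfl)

theorem dropTree (x : Tree) (m : List Sym) :
    Within dropTree (.mk (x.word ++ m) [] [] []) (6 * x.word.length + 3) (.mk m [] [] []) := by
  refine ((moveTree_left x m [] []).seq (clear_left _ _ _ _)).mono ?_
  simp only [List.append_nil, List.length_reverse]; omega

theorem swap (x y : Tree) (m : List Sym) :
    Within swap (.mk (x.word ++ (y.word ++ m)) [] [] []) (6 * (x.word.length + y.word.length) + 6)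
      (.mk (y.word ++ (x.word ++ m)) [] [] []) := by
  have h := (moveTree_left x (y.word ++ m) [] []).seq <| (moveTree_right y m _ []).seq <|
    (pour_left_main _ _ _ _).seq (pour_right_main _ _ _ _)
  simp only [List.append_nil, List.length_reverse, List.reverse_reverse] at h
  exact h.mono (by omega)

theorem dup (x : Tree) (m : List Sym) :
    Within dup (.mk (x.word ++ m) [] [] []) (10 * x.word.length + 5)
      (.mk (x.word ++ (x.word ++ m)) [] [] []) := by
  have h := (moveTree_left x m [] []).seq <| (copy_left _ _ _ _).seq <|
    (pour_right_left _ _ _ _).seq (pour_left_main _ _ _ _)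
  simp only [List.append_nil, List.length_reverse, List.reverse_reverse] at h
  exact h.mono (by omega)

theorem pushWord (w m l r c : List Sym) :
    Within (pushWord w) (.mk m l r c) (w.length + 2) (.mk (w ++ m) l r c) := by
  induction w with
  -- There is no empty command; pushing and dropping a symbol takes its place and accounts for the
  -- two extra steps.
  | nil =>
    simpa [Cmd.pushWord] using seq (push (S := .mk m l r c) (k := .main) (s := .one))
        (drop (k := .main))
  | cons s w ih =>
    have := ih.seq (push (k := .main) (s := s))
    simpa [Cmd.pushWord, add_right_comm] using this

end Within

/-! ### Coded types and polynomial-time functions -/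

/-- A type whose elements are coded by trees. -/
class Coded (α : Type) where
  /-- the code of an element -/
  code : α → Tree

/-- The word that codes an element. -/
def word {α : Type} [Coded α] (a : α) : List Sym := (Coded.code a).word

/-- The length of the code of an element. -/
def size {α : Type} [Coded α] (a : α) : ℕ := (word a).length

/-- The function `f` is computed on codes by a structured program in polynomial time. -/
def PolyTime {α β : Type} [Coded α] [Coded β] (f : α → β) : Prop :=
  ∃ (c : Cmd) (p : Polynomial ℕ), ∀ a, size (f a) ≤ p.eval (size a) ∧
    ∀ w, Within c (.mk (word a ++ w) [] [] []) (p.eval (size a)) (.mk (word (f a) ++ w) [] [] [])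

theorem monotone_eval (p : Polynomial ℕ) : Monotone fun n => p.eval n := by
  intro a b h
  simp only [Polynomial.eval_eq_sum, Polynomial.sum]
  gcongr

/-- Functions bounded by a polynomial in the size of the argument. -/
def PolyBdd {α : Type} [Coded α] (g : α → ℕ) : Prop :=
  ∃ p : Polynomial ℕ, ∀ a, g a ≤ p.eval (size a)

namespace PolyBdd

variable {α : Type} [Coded α] {g h : α → ℕ}

theorem mono (hh : PolyBdd h) (H : ∀ a, g a ≤ h a) : PolyBdd g :=
  let ⟨p, hp⟩ := hh
  ⟨p, fun a => (H a).trans (hp a)⟩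

theorem const (n : ℕ) : PolyBdd fun _ : α => n := ⟨Polynomial.C n, fun a => by simp⟩

theorem size : PolyBdd fun a : α => size a := ⟨Polynomial.X, fun a => by simp⟩

theorem add (hg : PolyBdd g) (hh : PolyBdd h) : PolyBdd fun a => g a + h a :=
  let ⟨p, hp⟩ := hg
  let ⟨q, hq⟩ := hh
  ⟨p + q, fun a => by simpa using Nat.add_le_add (hp a) (hq a)⟩

theorem mul (hg : PolyBdd g) (hh : PolyBdd h) : PolyBdd fun a => g a * h a :=
  let ⟨p, hp⟩ := hg
  let ⟨q, hq⟩ := hh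
  ⟨p * q, fun a => by simpa using Nat.mul_le_mul (hp a) (hq a)⟩

theorem eval (p : Polynomial ℕ) (hg : PolyBdd g) : PolyBdd fun a => p.eval (g a) :=
  let ⟨q, hq⟩ := hg
  ⟨p.comp q, fun a => by simpa using monotone_eval p (hq a)⟩

end PolyBdd

/-- To be computable in polynomial time, with separate bounds for size and time. -/
theorem PolyTime.of_within {α β : Type} [Coded α] [Coded β] {f : α → β} (c : Cmd) {g h : α → ℕ}
    (hg : PolyBdd g) (hh : PolyBdd h) (hs : ∀ a, size (f a) ≤ g a)
    (hr : ∀ a w, Within c (.mk (word a ++ w) [] [] []) (h a) (.mk (word (f a) ++ w) [] [] [])) :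
    PolyTime f := by
  obtain ⟨p, hp⟩ := hg
  obtain ⟨q, hq⟩ := hh
  refine ⟨c, p + q, fun a => ⟨?_, fun w => (hr a w).mono ?_⟩⟩
  · rw [Polynomial.eval_add]
    exact ((hs a).trans (hp a)).trans (Nat.le_add_right _ _)
  · rw [Polynomial.eval_add]
    exact (hq a).trans (Nat.le_add_left _ _)

theorem PolyTime.exists_within {α β : Type} [Coded α] [Coded β] {f : α → β} (hf : PolyTime f) :
    ∃ (c : Cmd) (p : Polynomial ℕ), (∀ a, size (f a) ≤ p.eval (size a)) ∧ ∀ a w,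
      Within c (.mk (word a ++ w) [] [] []) (p.eval (size a)) (.mk (word (f a) ++ w) [] [] []) :=
  let ⟨c, p, h⟩ := hf
  ⟨c, p, fun a => (h a).1, fun a => (h a).2⟩

theorem PolyTime.size {α β : Type} [Coded α] [Coded β] {f : α → β} (hf : PolyTime f) :
    PolyBdd fun a => size (f a) :=
  let ⟨_, p, h⟩ := hf
  ⟨p, fun a => (h a).1⟩

/-! ### Basic coded types -/

instance : Coded Sym := ⟨.leaf⟩
instance : Coded Bool := ⟨fun b => .leaf (if b then .one else .zero)⟩
instance : Coded Unit := ⟨fun _ => .leaf .zero⟩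
instance {α β : Type} [Coded α] [Coded β] : Coded (α × β) :=
  ⟨fun p => .node (Coded.code p.1) (Coded.code p.2)⟩

/-- The code of a list. -/
def codeList {α : Type} [Coded α] : List α → Tree
  | [] => .leaf .zero
  | a :: l => .node (Coded.code a) (codeList l)

instance {α : Type} [Coded α] : Coded (List α) := ⟨codeList⟩

section words

variable {α β : Type} [Coded α] [Coded β]

theorem word_mk (a : α) (b : β) : word (a, b) = .one :: (word a ++ word b) := rfl
theorem word_nil : word ([] : List α) = [.zero, .zero] := rfl
theorem word_cons (a : α) (l : List α) : word (a :: l) = .one :: (word a ++ word l) := rfl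
theorem word_sym (s : Sym) : word s = [.zero, s] := rfl
theorem word_true : word true = [.zero, .one] := rfl
theorem word_false : word false = [.zero, .zero] := rfl

@[simp] theorem size_mk (a : α) (b : β) : size (a, b) = size a + size b + 1 := by
  simp [size, word_mk]
@[simp] theorem size_nil : size ([] : List α) = 2 := rfl
@[simp] theorem size_cons (a : α) (l : List α) : size (a :: l) = size a + size l + 1 := by
  simp [size, word_cons]
@[simp] theorem size_sym (s : Sym) : size s = 2 := rfl
@[simp] theorem size_bool (b : Bool) : size b = 2 := rfl
@[simp] theorem size_unit (u : Unit) : size u = 2 := rfl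

end words

/-! ### Closure properties of polynomial-time functions -/

namespace PolyTime

open Cmd

variable {α β γ δ : Type} [Coded α] [Coded β] [Coded γ] [Coded δ]

/-- Only codes matter to a program, so leaving the stacks as they are computes every function that
preserves codes. -/
theorem of_word_eq {f : α → β} (h : ∀ a, word (f a) = word a) : PolyTime f := by
  refine of_within (.pushWord []) PolyBdd.size (PolyBdd.const 2) (fun a => ?_) fun a w => ?_
  · simp [BAP.size, h]
  · simpa [h] using Within.pushWord [] (word a ++ w) [] [] []

theorem id : PolyTime fun a : α => a := of_word_eq fun _ => rfl

theorem comp {g : β → γ} {f : α → β} (hg : PolyTime g) (hf : PolyTime f) :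
    PolyTime fun a => g (f a) := by
  obtain ⟨c, p, hs, hc⟩ := hf.exists_within
  obtain ⟨d, q, hs', hd⟩ := hg.exists_within
  exact of_within (.seq c d) (hf.size.eval q) ((PolyBdd.size.eval p).add (hf.size.eval q))
    (fun a => hs' _) fun a w => (hc a w).seq (hd (f a) w)

theorem const (b : β) : PolyTime fun _ : α => b := by
  refine of_within (.seq dropTree (pushWord (word b))) (PolyBdd.const (BAP.size b))
    (((PolyBdd.const 6).mul PolyBdd.size |>.add (.const 3)).add (.const (BAP.size b + 2)))
    (fun a => le_rfl) fun a w => ?_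
  exact (Within.dropTree _ w).seq (Within.pushWord _ _ _ _ _)

/-- The argument is duplicated, and each function is evaluated on top of a saved tree. This is why
`PolyTime` demands a run above an arbitrary rest `w` of the stack. The final push supplies the node
marker of the pair. -/
theorem pair {f : α → β} {g : α → γ} (hf : PolyTime f) (hg : PolyTime g) :
    PolyTime fun a => (f a, g a) := by
  obtain ⟨c, p, hs, hc⟩ := hf.exists_within
  obtain ⟨d, q, hs', hd⟩ := hg.exists_within
  refine of_within (.seq dup <| .seq c <| .seq swap <| .seq d <| .seq swap <| .push .main .one)
    ((hf.size.add hg.size).add (.const 1))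
    (((PolyBdd.const 10).mul PolyBdd.size |>.add (.const 5)).add <|
      (PolyBdd.size.eval p).add <| (((PolyBdd.const 6).mul (hf.size.add PolyBdd.size)).add
      (.const 6)).add <| (PolyBdd.size.eval q).add <|
      (((PolyBdd.const 6).mul (hg.size.add hf.size)).add (.const 6)).add (.const 1))
    (fun a => by simp) fun a w => ?_
  refine (Within.dup _ w).seq <| (hc a _).seq <| (Within.swap _ _ _).seq <| (hd a _).seq <|
    (Within.swap _ _ _).seq ?_
  have := Within.push (S := .mk (word (f a) ++ (word (g a) ++ w)) [] [] []) (k := .main) (s := .one)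
  rw [word_mk]
  simpa [word] using this

theorem fst : PolyTime fun p : α × β => p.1 := by
  refine of_within (.seq (.drop .main) <| .seq swap dropTree) PolyBdd.size
    (((PolyBdd.const 1).add (((PolyBdd.const 6).mul PolyBdd.size).add (.const 6))).add
      (((PolyBdd.const 6).mul PolyBdd.size).add (.const 3)))
    (fun a => ?_) fun a w => ?_
  · obtain ⟨a, b⟩ := a
    simp only [size_mk]; omega
  · obtain ⟨a, b⟩ := a
    have h1 := (Within.drop (S := .mk (word (a, b) ++ w) [] [] []) (k := .main))
    simp only [word_mk, Store.tail_main, List.cons_append, List.tail_cons, List.append_assoc] at h1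
    have h2 := Within.swap (Coded.code a) (Coded.code b) w
    have h3 := Within.dropTree (Coded.code b) (word a ++ w)
    simp only [word_mk, List.cons_append, List.append_assoc]
    refine (h1.seq (h2.seq h3)).mono ?_
    simp only [size_mk]
    simp only [BAP.size, word]; omega

theorem snd : PolyTime fun p : α × β => p.2 := by
  refine of_within (.seq (.drop .main) dropTree) PolyBdd.size
    ((PolyBdd.const 1).add (((PolyBdd.const 6).mul PolyBdd.size).add (.const 3)))
    (fun a => ?_) fun a w => ?_
  · obtain ⟨a, b⟩ := a
    simp only [size_mk]; omega
  · obtain ⟨a, b⟩ := a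
    have h1 := (Within.drop (S := .mk (word (a, b) ++ w) [] [] []) (k := .main))
    simp only [word_mk, Store.tail_main, List.cons_append, List.tail_cons, List.append_assoc] at h1
    have h3 := Within.dropTree (Coded.code a) (word b ++ w)
    simp only [word_mk, List.cons_append, List.append_assoc]
    refine (h1.seq h3).mono ?_
    simp only [size_mk]
    simp only [BAP.size, word]; omega

/-- Once the pair `(b a, a)` has been computed, dropping the node marker and the leaf marker exposes
the symbol of the Boolean, with the code of `a` intact below it. -/
theorem ite {b : α → Bool} {f g : α → β} (hb : PolyTime b) (hf : PolyTime f) (hg : PolyTime g) :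
    PolyTime fun a => if b a then f a else g a := by
  obtain ⟨e, u, hs, he⟩ := (hb.pair PolyTime.id).exists_within
  obtain ⟨c, p, hs', hc⟩ := hf.exists_within
  obtain ⟨d, q, hs'', hd⟩ := hg.exists_within
  refine of_within (.seq e <| .seq (.drop .main) <| .seq (.drop .main) <|
      .ite .main (· == some .one) (.seq (.drop .main) c) (.seq (.drop .main) d))
    ((PolyBdd.size.eval p).add (PolyBdd.size.eval q))
    ((PolyBdd.size.eval u).add <| (PolyBdd.const 1).add <| (PolyBdd.const 1).add <|
      ((PolyBdd.const 1).add ((PolyBdd.size.eval p).add (PolyBdd.size.eval q))).add (.const 1))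
    (fun a => ?_) fun a w => (he a w).seq ?_
  · have := hs' a
    have := hs'' a
    split <;> omega
  · cases hba : b a
    · refine Within.drop.seq <| Within.drop.seq <| Within.ite_false ?_ <| Within.drop.seq ?_
      · simp [word_mk, word_false]
      · simpa [word_mk, word_false] using (hd a w).mono (Nat.le_add_left _ _)
    · refine Within.drop.seq <| Within.drop.seq <| Within.ite_true ?_ <| Within.drop.seq ?_
      · simp [word_mk, word_true]
      · simpa [word_mk, word_true] using (hc a w).mono (Nat.le_add_right _ _)

/-- The alphabet is finite, so any predicate can be built into a branch of the program. -/
theorem sym_test (h : Sym → Bool) : PolyTime h := by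
  refine of_within (.seq (.drop .main) <| .ite .main (fun o => h (o.getD .zero))
      (.seq (.drop .main) (pushWord [.zero, .one])) (.seq (.drop .main) (pushWord [.zero, .zero])))
    (.const 2) (.const 7) (fun a => le_rfl) fun a w => ?_
  cases ha : h a
  · exact Within.mono (Within.drop.seq <| Within.ite_false (by simp [word_sym, ha]) <|
      Within.drop.seq (by
        simpa [word_sym, word_false] using Within.pushWord [.zero, .zero] w [] [] []))
      (by simp)
  · exact Within.mono (Within.drop.seq <| Within.ite_true (by simp [word_sym, ha]) <|
      Within.drop.seq (by
        simpa [word_sym, word_true] using Within.pushWord [.zero, .one] w [] [] []))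
      (by simp)

/-- A nonempty list `x :: t` has the same code as the pair `(x, t)`. Its first symbol decides the
case, and one pushed marker turns the list and the saved argument into the code of `((x, t), a)`. -/
theorem list_cases {l : α → List β} {f : α → γ} {g : α → β → List β → γ} (hl : PolyTime l)
    (hf : PolyTime f) (hg : PolyTime fun p : (β × List β) × α => g p.2 p.1.1 p.1.2) :
    PolyTime fun a => match l a with
      | [] => f a
      | x :: t => g a x t := by
  obtain ⟨e, u, hs, he⟩ := (hl.pair PolyTime.id).exists_within
  obtain ⟨c, p, hs', hc⟩ := hf.exists_within
  obtain ⟨d, q, hs'', hd⟩ := hg.exists_within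
  have hsz := (hl.pair PolyTime.id).size
  refine of_within (.seq e <| .seq (.drop .main) <|
      .ite .main (· == some .one) (.seq (.push .main .one) d)
        (.seq (.drop .main) (.seq (.drop .main) c)))
    ((PolyBdd.size.eval p).add (hsz.eval q))
    ((PolyBdd.size.eval u).add <| (PolyBdd.const 1).add <|
      ((PolyBdd.const 2).add ((PolyBdd.size.eval p).add (hsz.eval q))).add (.const 1))
    (fun a => ?_) fun a w => (he a w).seq ?_
  · split
    · exact (hs' a).trans (Nat.le_add_right _ _)
    · next x t h =>
      rw [h]
      exact (hs'' ((x, t), a)).trans (Nat.le_add_left _ _)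
  · split
    · next h =>
      rw [h]
      refine Within.drop.seq <| Within.ite_false (by simp [word_mk, word_nil])
        ((Within.drop.seq <| Within.drop.seq (T' := p.eval (BAP.size a)) ?_).mono (by omega))
      simpa [word_mk, word_nil] using hc a w
    · next x t h =>
      rw [h]
      refine Within.drop.seq <| Within.ite_true (by simp [word_mk, word_cons])
        ((Within.push.seq (T' := q.eval (BAP.size (x :: t, a))) ?_).mono (by omega))
      simpa [word_mk, word_cons] using hd ((x, t), a) w

/-- Iteration over a list; the values on the way have to be of polynomial size. -/
theorem foldl {l : α → List β} {i : α → γ} {f : α → γ → β → γ} (hl : PolyTime l) (hi : PolyTime i)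
    (hf : PolyTime fun p : α × γ × β => f p.1 p.2.1 p.2.2) {B : α → ℕ} (hB : PolyBdd B)
    (h : ∀ a t, t <+: l a → BAP.size (t.foldl (f a) (i a)) ≤ B a) :
    PolyTime fun a => (l a).foldl (f a) (i a) := by
  have hbody : PolyTime fun s : (β × List β) × (α × γ) => (s.1.2, (s.2.1, f s.2.1 s.2.2 s.1.1)) :=
    (snd.comp fst).pair ((fst.comp snd).pair
      (hf.comp ((fst.comp snd).pair ((snd.comp snd).pair (fst.comp fst)))))
  obtain ⟨e, u, hs, he⟩ := (hl.pair (PolyTime.id.pair hi)).exists_within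
  obtain ⟨d, q, hs', hd⟩ := hbody.exists_within
  -- Between two rounds the stack holds the remaining list and the pair `(a, c)` without a common
  -- marker, so that the first symbol of the list is exposed to the test. Pushing the marker
  -- produces the argument of the body. The bounds `L` and `b` for the list and the accumulator are
  -- kept fixed, which gives all rounds the same time bound; the additional `3` pays for the test,
  -- the push and the drop.
  have hloop : ∀ (a : α) (L b : ℕ) (w : List Sym) (t : List β) (c : γ), BAP.size t ≤ L →
      (∀ t', t' <+: t → BAP.size (t'.foldl (f a) c) ≤ b) →
      Within (.loop .main (· == some .one) (.seq (.push .main .one) (.seq d (.drop .main))))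
        (.mk (word t ++ (word (a, c) ++ w)) [] [] [])
        (BAP.size t * (q.eval (BAP.size a + L + b + 2) + 3) + 1)
        (.mk (word ([] : List β) ++ (word (a, t.foldl (f a) c) ++ w)) [] [] []) := by
    intro a L b w t
    induction t with
    | nil => intro c _ _; exact (Within.loop_done rfl).mono (Nat.le_add_left _ _)
    | cons x t ih =>
      intro c hL hb
      have hL' : BAP.size x + BAP.size t + 1 ≤ L := by simpa using hL
      have hc := hb [] (List.nil_prefix)
      simp only [List.foldl_nil] at hc
      have h1 := hd ((x, t), (a, c)) w
      have h2 := Within.drop (S := .mk (word (t, (a, f a c x)) ++ w) [] [] []) (k := .main)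
      have h3 := ih (f a c x) (by omega) fun t' ht' => by
        have := hb (x :: t') (List.cons_prefix_cons.2 ⟨rfl, ht'⟩)
        simpa using this
      have h4 := monotone_eval q (show BAP.size ((x, t), (a, c)) ≤ BAP.size a + L + b + 2 by
        simp only [size_mk]; omega)
      refine (Within.loop_step (by simp [word_cons]) (Within.push.seq
        ((?_ : Within d _ (q.eval (BAP.size a + L + b + 2)) _).seq h2)) ?_).mono
          (T := 1 + (q.eval (BAP.size a + L + b + 2) + 1) +
            (BAP.size t * (q.eval (BAP.size a + L + b + 2) + 3) + 1) + 1) ?_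
      · simpa [word_mk, word_cons] using h1.mono h4
      · simpa [word_mk, word_cons] using h3
      · simp only [size_cons]
        generalize q.eval (BAP.size a + L + b + 2) = Q
        nlinarith [Nat.zero_le (BAP.size x * (Q + 3))]
  have hmain : PolyTime fun a => (([] : List β), (a, (l a).foldl (f a) (i a))) := by
    refine of_within (.seq e <| .seq (.drop .main) <| .seq
        (.loop .main (· == some .one) (.seq (.push .main .one) (.seq d (.drop .main))))
        (.push .main .one))
      ((PolyBdd.size.add hB).add (.const 4))
      ((PolyBdd.size.eval u).add <| (PolyBdd.const 1).add <|
        ((hl.size.mul ((((PolyBdd.size.add hl.size).add hB).add (.const 2)).eval q |>.add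
          (.const 3))).add (.const 1)).add (.const 1))
      (fun a => ?_) fun a w => (he a w).seq ?_
    · have := h a (l a) List.prefix_rfl
      simp only [size_mk, size_nil]; omega
    · refine Within.drop.seq <| Within.seq
        (S' := .mk (word ([] : List β) ++ (word (a, (l a).foldl (f a) (i a)) ++ w)) [] [] []) ?_ ?_
      · simpa [word_mk] using hloop a (BAP.size (l a)) (B a) w (l a) (i a) le_rfl (h a)
      · have := Within.push (k := .main) (s := .one)
          (S := .mk (word ([] : List β) ++ (word (a, (l a).foldl (f a) (i a)) ++ w)) [] [] [])
        simpa [word_mk] using this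
  exact snd.comp (snd.comp hmain)

end PolyTime

/-! ### Sizes of lists -/

section sizes

variable {α β : Type} [Coded α] [Coded β]

/-- The end marker of `l`, two symbols long, disappears in the concatenation. -/
theorem size_append (l m : List α) : size (l ++ m) + 2 = size l + size m := by
  induction l with
  | nil => simp [add_comm]
  | cons x l ih => simp only [List.cons_append, size_cons]; omega

theorem size_reverse (l : List α) : size l.reverse = size l := by
  induction l with
  | nil => rfl
  | cons x l ih =>
    have := size_append l.reverse [x]
    simp only [List.reverse_cons, size_cons, size_nil] at this ⊢
    omega

theorem length_add_two_le_size (l : List α) : l.length + 2 ≤ size l := by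
  induction l with
  | nil => rfl
  | cons x l ih => simp only [List.length_cons, size_cons]; omega

theorem size_lt_of_mem {l : List α} {x : α} (h : x ∈ l) : size x < size l := by
  induction l with
  | nil => simp at h
  | cons y l ih =>
    rw [size_cons]
    rcases List.mem_cons.1 h with rfl | h
    · omega
    · have := ih h; omega

theorem size_le_of_prefix {t l : List α} (h : t <+: l) : size t ≤ size l := by
  obtain ⟨u, rfl⟩ := h
  have := size_append t u
  have := length_add_two_le_size u
  omega

theorem size_le_of_suffix {t l : List α} (h : t <:+ l) : size t ≤ size l := by
  obtain ⟨u, rfl⟩ := h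
  have := size_append u t
  have := length_add_two_le_size u
  omega

theorem size_le_of_forall {l : List α} {b : ℕ} (h : ∀ x ∈ l, size x ≤ b) :
    size l ≤ l.length * (b + 1) + 2 := by
  induction l with
  | nil => simp
  | cons x l ih =>
    have h1 := h x (by simp)
    have h2 := ih fun y hy => h y (by simp [hy])
    simp only [List.length_cons, size_cons, Nat.add_mul]
    omega

theorem size_tail_le (l : List α) : size l.tail ≤ size l := size_le_of_suffix (List.tail_suffix l)

end sizes

theorem size_flatMap_le {α β : Type} [Coded β] {l : List α} {g : α → List β} {b : ℕ}
    (h : ∀ x ∈ l, size (g x) ≤ b) : size (l.flatMap g) ≤ l.length * b + 2 := by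
  induction l with
  | nil => simp
  | cons x l ih =>
    have h1 := h x (by simp)
    have h2 := ih fun y hy => h y (by simp [hy])
    have := size_append (g x) (l.flatMap g)
    simp only [List.length_cons, List.flatMap_cons, Nat.add_mul]
    omega

namespace PolyTime

variable {α β γ δ : Type} [Coded α] [Coded β] [Coded γ] [Coded δ]

/-- Types such as `Unary`, `ℕ`, `ℤ` and `Fraction` borrow their codes from lists and pairs; this
makes the passage between a type and its representation free of charge. -/
theorem of_word_congr {f : α → β} (hf : PolyTime f) {g : α → γ} (h : ∀ a, word (g a) = word (f a)) :
    PolyTime g := by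
  obtain ⟨c, p, hs, hc⟩ := hf.exists_within
  refine of_within c (PolyBdd.size.eval p) (PolyBdd.size.eval p) (fun a => ?_) fun a w => ?_
  · simpa [BAP.size, h] using hs a
  · simpa [h] using hc a w

/-! ### Booleans -/

theorem and {f g : α → Bool} (hf : PolyTime f) (hg : PolyTime g) :
    PolyTime fun a => f a && g a := by
  convert hf.ite hg (const false) using 2 with a
  cases f a <;> simp

theorem not {f : α → Bool} (hf : PolyTime f) : PolyTime fun a => !f a := by
  convert hf.ite (const false) (const true) using 2 with a
  cases f a <;> simp

theorem or {f g : α → Bool} (hf : PolyTime f) (hg : PolyTime g) : PolyTime fun a => f a || g a := by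
  convert hf.ite (const true) hg using 2 with a
  cases f a <;> simp

theorem xor {f g : α → Bool} (hf : PolyTime f) (hg : PolyTime g) :
    PolyTime fun a => f a ^^ g a := by
  convert hf.ite hg.not hg using 2 with a
  cases f a <;> simp

/-! ### Lists -/

theorem cons {f : α → β} {l : α → List β} (hf : PolyTime f) (hl : PolyTime l) :
    PolyTime fun a => f a :: l a :=
  (hf.pair hl).of_word_congr fun _ => rfl

theorem tail {l : α → List β} (hl : PolyTime l) : PolyTime fun a => (l a).tail := by
  convert hl.list_cases (const ([] : List β)) (g := fun _ _ t => t) (snd.comp fst) using 2 with a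
  cases l a <;> rfl

theorem headD {l : α → List β} {d : α → β} (hl : PolyTime l) (hd : PolyTime d) :
    PolyTime fun a => (l a).headD (d a) := by
  convert hl.list_cases hd (g := fun _ x _ => x) (fst.comp fst) using 2 with a
  cases l a <;> rfl

theorem isEmpty {l : α → List β} (hl : PolyTime l) : PolyTime fun a => (l a).isEmpty := by
  convert hl.list_cases (const true) (g := fun _ _ _ => false) (const false) using 2 with a
  cases l a <;> rfl

theorem reverse {l : α → List β} (hl : PolyTime l) : PolyTime fun a => (l a).reverse := by
  have := hl.foldl (const ([] : List β)) (f := fun _ t x => x :: t)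
    ((snd.comp snd).cons (fst.comp snd)) hl.size fun a t ht => ?_
  · simpa using this
  · simpa [size_reverse] using size_le_of_prefix ht

theorem foldr {l : α → List β} {i : α → γ} {f : α → β → γ → γ} (hl : PolyTime l) (hi : PolyTime i)
    (hf : PolyTime fun p : α × β × γ => f p.1 p.2.1 p.2.2) {B : α → ℕ} (hB : PolyBdd B)
    (h : ∀ a t, t <:+ l a → BAP.size (t.foldr (f a) (i a)) ≤ B a) :
    PolyTime fun a => (l a).foldr (f a) (i a) := by
  have := hl.reverse.foldl hi (f := fun a y x => f a x y)
    (hf.comp (fst.pair ((snd.comp snd).pair (fst.comp snd)))) hB fun a t ht => ?_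
  · simpa using this
  · have := h a t.reverse (by rwa [← List.reverse_prefix, List.reverse_reverse])
    simpa using this

theorem append {l m : α → List β} (hl : PolyTime l) (hm : PolyTime m) :
    PolyTime fun a => l a ++ m a := by
  have key : ∀ t u : List β, t.foldr (fun x y => x :: y) u = t ++ u := fun t u => by simp
  have := hl.foldr hm (f := fun _ x t => x :: t) ((fst.comp snd).cons (snd.comp snd))
    (hl.size.add hm.size) fun a t ht => ?_
  · simpa [key] using this
  · have h1 := size_append t (m a)
    have h2 := size_le_of_suffix ht
    rw [key]; omega

theorem map {l : α → List β} {g : α → β → γ} (hl : PolyTime l)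
    (hg : PolyTime fun p : α × β => g p.1 p.2) : PolyTime fun a => (l a).map (g a) := by
  have key : ∀ (a : α) (t : List β), t.foldr (fun x y => g a x :: y) [] = t.map (g a) :=
    fun a t => by induction t with
      | nil => rfl
      | cons x t ih => simp [ih]
  obtain ⟨p, hp⟩ := hg.size
  have := hl.foldr (const ([] : List γ)) (f := fun a x t => g a x :: t)
    ((hg.comp (fst.pair (fst.comp snd))).cons (snd.comp snd))
    ((hl.size.mul ((((PolyBdd.size (α := α)).add hl.size).add (.const 1)).eval p |>.add
      (.const 1))).add (.const 2)) fun a t ht => ?_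
  · simpa only [key] using this
  · simp only [key]
    refine (size_le_of_forall (b := p.eval (BAP.size a + BAP.size (l a) + 1)) ?_).trans ?_
    · intro y hy
      obtain ⟨x, hx, rfl⟩ := List.mem_map.1 hy
      refine (hp (a, x)).trans (monotone_eval p ?_)
      have := size_lt_of_mem (ht.subset hx)
      simp only [size_mk]; omega
    · have := length_add_two_le_size t
      have := size_le_of_suffix ht
      rw [List.length_map]
      gcongr
      omega

theorem flatMap {l : α → List β} {g : α → β → List γ} (hl : PolyTime l)
    (hg : PolyTime fun p : α × β => g p.1 p.2) : PolyTime fun a => (l a).flatMap (g a) := by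
  have key : ∀ (a : α) (t : List β), t.foldr (fun x y => g a x ++ y) [] = t.flatMap (g a) :=
    fun a t => by induction t with
      | nil => rfl
      | cons x t ih => simp [ih]
  obtain ⟨p, hp⟩ := hg.size
  have := hl.foldr (const ([] : List γ)) (f := fun a x t => g a x ++ t)
    ((hg.comp (fst.pair (fst.comp snd))).append (snd.comp snd))
    ((hl.size.mul ((((PolyBdd.size (α := α)).add hl.size).add (.const 1)).eval p)).add
      (.const 2)) fun a t ht => ?_
  · simpa only [key] using this
  · simp only [key]
    refine (size_flatMap_le (b := p.eval (BAP.size a + BAP.size (l a) + 1)) ?_).trans ?_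
    · intro x hx
      refine (hp (a, x)).trans (monotone_eval p ?_)
      have := size_lt_of_mem (ht.subset hx)
      simp only [size_mk]; omega
    · have := length_add_two_le_size t
      have := size_le_of_suffix ht
      gcongr
      omega

theorem all {l : α → List β} {g : α → β → Bool} (hl : PolyTime l)
    (hg : PolyTime fun p : α × β => g p.1 p.2) : PolyTime fun a => (l a).all (g a) := by
  have key : ∀ (a : α) (t : List β), t.foldr (fun x y => g a x && y) true = t.all (g a) :=
    fun a t => by induction t with
      | nil => rfl
      | cons x t ih => simp [ih]
  have := hl.foldr (const true) (f := fun a x t => g a x && t)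
    ((hg.comp (fst.pair (fst.comp snd))).and (snd.comp snd)) (.const 2) fun a t ht => by simp
  simpa only [key] using this

/-- Iteration over a list, when a measure of the value grows by a bounded amount in each step. -/
theorem foldl_of_measure {l : α → List β} {i : α → γ} {f : α → γ → β → γ} (hl : PolyTime l)
    (hi : PolyTime i) (hf : PolyTime fun p : α × γ × β => f p.1 p.2.1 p.2.2) (μ : γ → ℕ) (C : ℕ)
    (hμ : ∀ c, BAP.size c ≤ C * μ c + C) (hμi : PolyBdd fun a => μ (i a)) {D : α → ℕ}
    (hD : PolyBdd D) (h : ∀ a c, ∀ x ∈ l a, μ (f a c x) ≤ μ c + D a) :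
    PolyTime fun a => (l a).foldl (f a) (i a) := by
  have key : ∀ (a : α) (t : List β) (c : γ), (∀ x ∈ t, x ∈ l a) →
      μ (t.foldl (f a) c) ≤ μ c + t.length * D a := by
    intro a t
    induction t with
    | nil => intro c _; simp
    | cons x t ih =>
      intro c ht
      have h1 := h a c x (ht x (by simp))
      have h2 := ih (f a c x) fun y hy => ht y (by simp [hy])
      simp only [List.foldl_cons, List.length_cons, Nat.add_mul]
      omega
  refine hl.foldl hi hf (((PolyBdd.const C).mul (hμi.add (hl.size.mul hD))).add (.const C))
    fun a t ht => (hμ _).trans ?_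
  have h1 := key a t (i a) fun x hx => ht.subset hx
  have h2 := length_add_two_le_size t
  have h3 := size_le_of_prefix ht
  gcongr
  refine h1.trans ?_
  gcongr
  omega

end PolyTime

/-! ### Natural numbers in unary -/

/-- A natural number that is coded in unary. -/
structure Unary where
  /-- the number -/
  val : ℕ

instance : Coded Unary := ⟨fun u => Coded.code (List.replicate u.val ())⟩

theorem word_unary (u : Unary) : word u = word (List.replicate u.val ()) := rfl

theorem size_unary (u : Unary) : size u = 3 * u.val + 2 := by
  obtain ⟨n⟩ := u
  induction n with
  | zero => rfl
  | succ n ih =>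
    simp only [size, word_unary] at ih ⊢
    change size (List.replicate n ()) = _ at ih
    change size (List.replicate (n + 1) ()) = _
    rw [List.replicate_succ, size_cons, ih, size_unit]
    ring

theorem foldl_const_eq_iterate {β γ : Type} (g : γ → γ) (l : List β) (c : γ) :
    l.foldl (fun s _ => g s) c = g^[l.length] c := by
  induction l generalizing c with
  | nil => rfl
  | cons x l ih => simp [ih]

namespace PolyTime

variable {α β γ : Type} [Coded α] [Coded β] [Coded γ]

theorem unary_list {u : α → Unary} (hu : PolyTime u) :
    PolyTime fun a => List.replicate (u a).val () := hu.of_word_congr fun _ => rfl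

theorem unary_of_list {l : α → List Unit} (hl : PolyTime l) :
    PolyTime fun a => Unary.mk (l a).length := by
  refine hl.of_word_congr fun a => ?_
  rw [word_unary]
  congr 1
  exact (List.eq_replicate_of_mem fun _ _ => rfl).symm

theorem length {l : α → List β} (hl : PolyTime l) : PolyTime fun a => Unary.mk (l a).length := by
  simpa using (hl.map (g := fun _ _ => ()) (const ())).unary_of_list

theorem unary_add {u v : α → Unary} (hu : PolyTime u) (hv : PolyTime v) :
    PolyTime fun a => Unary.mk ((u a).val + (v a).val) := by
  simpa using (hu.unary_list.append hv.unary_list).unary_of_list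

theorem unary_mul {u v : α → Unary} (hu : PolyTime u) (hv : PolyTime v) :
    PolyTime fun a => Unary.mk ((u a).val * (v a).val) := by
  simpa using (hu.unary_list.flatMap (g := fun a _ => List.replicate (v a).val ())
    (hv.unary_list.comp fst)).unary_of_list

/-- The list `0, ..., n - 1`. -/
theorem unary_range {u : α → Unary} (hu : PolyTime u) :
    PolyTime fun a => (List.range (u a).val).map Unary.mk := by
  -- The list is its own counter: each round appends the current length.
  have key : ∀ (n : ℕ) (t : List Unit), t.length = n →
      t.foldl (fun (s : List Unary) _ => s ++ [Unary.mk s.length]) [] =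
        (List.range n).map Unary.mk := by
    intro n t ht
    rw [foldl_const_eq_iterate, ht]
    clear ht
    induction n with
    | zero => rfl
    | succ n ih => rw [Function.iterate_succ_apply', ih, List.range_succ]; simp
  have := hu.unary_list.foldl (const ([] : List Unary))
    (f := fun _ s _ => s ++ [Unary.mk s.length])
    ((fst.comp snd).append ((length (fst.comp snd)).cons (const [])))
    ((hu.size.mul (hu.size.add (.const 1))).add (.const 2)) fun a t ht => ?_
  · convert this using 2 with a
    exact (key _ _ (by simp)).symm
  · have h1 := size_unary (u a)
    have h2 : t.length ≤ (u a).val := by simpa using ht.length_le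
    rw [key _ t rfl]
    refine (size_le_of_forall (b := BAP.size (u a)) ?_).trans ?_
    · intro x hx
      obtain ⟨k, hk, rfl⟩ := List.mem_map.1 hx
      rw [List.mem_range] at hk
      rw [size_unary (Unary.mk k), h1]
      dsimp only; omega
    · rw [List.length_map, List.length_range]
      gcongr
      omega

theorem drop {l : α → List β} {u : α → Unary} (hl : PolyTime l) (hu : PolyTime u) :
    PolyTime fun a => (l a).drop (u a).val := by
  have key : ∀ (t : List Unit) (m : List β), t.foldl (fun s _ => s.tail) m = m.drop t.length := by
    intro t m
    rw [foldl_const_eq_iterate (fun s : List β => s.tail)]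
    induction t.length with
    | zero => rfl
    | succ n ih => rw [Function.iterate_succ_apply', ih, List.tail_drop]
  have := hu.unary_list.foldl hl (f := fun _ s _ => s.tail) (fst.comp snd).tail hl.size
    fun a t ht => ?_
  · simpa [key] using this
  · rw [key]
    exact size_le_of_suffix (List.drop_suffix _ _)

theorem getD {l : α → List β} {u : α → Unary} {d : α → β} (hl : PolyTime l) (hu : PolyTime u)
    (hd : PolyTime d) : PolyTime fun a => (l a).getD (u a).val (d a) := by
  convert (hl.drop hu).headD hd using 2 with a
  simp [List.getD_eq_getElem?_getD, List.head?_drop, List.headD_eq_head?_getD]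

end PolyTime

/-! ### Natural numbers in binary -/

instance : Coded ℕ := ⟨fun n => Coded.code n.bits⟩

theorem word_nat (n : ℕ) : word n = word n.bits := rfl

theorem size_nat (n : ℕ) : size n = 3 * n.size + 2 := by
  have : ∀ l : List Bool, size l = 3 * l.length + 2 := by
    intro l
    induction l with
    | nil => rfl
    | cons x l ih => simp only [size_cons, List.length_cons, ih, size_bool]; ring
  rw [size, word_nat, ← size, this, ← Nat.size_eq_bits_len]

theorem size_bit_le (b : Bool) (n : ℕ) : (Nat.bit b n).size ≤ n.size + 1 := by
  by_cases h : Nat.bit b n = 0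
  · simp [h]
  · rw [Nat.size_bit h]

theorem nat_size_add_le (m n : ℕ) : (m + n).size ≤ m.size + n.size + 1 := by
  rw [Nat.size_le]
  have h1 := Nat.lt_size_self m
  have h2 := Nat.lt_size_self n
  have h3 : 2 ^ m.size ≤ 2 ^ (m.size + n.size) := Nat.pow_le_pow_right (by norm_num) (by omega)
  have h4 : 2 ^ n.size ≤ 2 ^ (m.size + n.size) := Nat.pow_le_pow_right (by norm_num) (by omega)
  rw [pow_succ]
  omega

theorem nat_size_mul_le (m n : ℕ) : (m * n).size ≤ m.size + n.size := by
  rw [Nat.size_le, pow_add]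
  exact Nat.mul_lt_mul'' (Nat.lt_size_self m) (Nat.lt_size_self n)

/-! ### Binary addition and subtraction with carries -/

/-- One step of addition (`s = 1`) or subtraction (`s = -1`) with carries given by `f`. -/
def rippleStep (f : Bool → Bool → Bool → Bool) (s : ℕ × ℕ × Bool × List Bool) :
    ℕ × ℕ × Bool × List Bool :=
  (s.1.div2, s.2.1.div2, f s.1.bodd s.2.1.bodd s.2.2.1,
    (s.1.bodd ^^ (s.2.1.bodd ^^ s.2.2.1)) :: s.2.2.2)

/-- The integer with given leading part and the given binary digits. -/
def horner (l : List Bool) (z : ℤ) : ℤ := l.foldl (fun z b => 2 * z + b.toNat) z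

/-- Carry and binary digits, most significant digit first. -/
def ripple (f : Bool → Bool → Bool → Bool) (x y : ℕ) : Bool × List Bool :=
  ((x.bits ++ y.bits).foldl (fun s _ => rippleStep f s) (x, y, false, [])).2.2

/-- The hypothesis is the full-adder identity for one column; subtraction is the case `s = -1`,
where the carry is a borrow and the digit is still the exclusive or. The invariant is that the
remaining `x + s * y + s * carry`, followed by the digits found so far, always represents the same
integer. At the end only the signed carry remains as leading part. -/
theorem horner_ripple {f : Bool → Bool → Bool → Bool} {s : ℤ}
    (hf : ∀ a b c : Bool, (a.toNat : ℤ) + s * b.toNat + s * c.toNat =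
      2 * (s * (f a b c).toNat) + (a ^^ (b ^^ c)).toNat) (x y : ℕ) :
    horner (ripple f x y).2 (s * (ripple f x y).1.toNat) = x + s * y := by
  have key : ∀ (l : List Bool) (x y : ℕ) (c : Bool) (o : List Bool), x.size ≤ l.length →
      y.size ≤ l.length →
      horner (l.foldl (fun s _ => rippleStep f s) (x, y, c, o)).2.2.2
        (s * (l.foldl (fun s _ => rippleStep f s) (x, y, c, o)).2.2.1.toNat) =
      horner o (x + s * y + s * c.toNat) := by
    intro l
    induction l with
    | nil =>
      intro x y c o hx hy
      have hx' : x = 0 := Nat.size_eq_zero.1 (by simpa using hx)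
      have hy' : y = 0 := Nat.size_eq_zero.1 (by simpa using hy)
      simp [hx', hy']
    | cons b l ih =>
      have hsz : ∀ x : ℕ, x.size ≤ l.length + 1 → x.div2.size ≤ l.length := by
        intro x hx
        by_cases h0 : x = 0
        · simp [h0]
        · rw [← Nat.bit_bodd_div2 x] at hx h0
          rw [Nat.size_bit h0] at hx
          omega
      intro x y c o hx hy
      have h := ih x.div2 y.div2 (f x.bodd y.bodd c) ((x.bodd ^^ (y.bodd ^^ c)) :: o)
        (hsz x hx) (hsz y hy)
      rw [List.foldl_cons]
      refine h.trans ?_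
      rw [horner, List.foldl_cons, ← horner]
      congr 1
      have h1 := hf x.bodd y.bodd c
      have hb : ∀ x : ℕ, (x : ℤ) = x.bodd.toNat + 2 * x.div2 := by
        intro x
        exact_mod_cast (Nat.bodd_add_div2 x).symm
      rw [hb x, hb y]
      linear_combination -h1
  -- The concatenated digits serve only as a clock, long enough for either number.
  have := key (x.bits ++ y.bits) x y false [] (by simp [Nat.size_eq_bits_len])
    (by simp [Nat.size_eq_bits_len])
  simpa [horner, ripple] using this

namespace PolyTime

variable {α β γ : Type} [Coded α] [Coded β] [Coded γ] {m n : α → ℕ}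

theorem nat_bits (hm : PolyTime m) : PolyTime fun a => (m a).bits :=
  hm.of_word_congr fun _ => rfl

theorem nat_eq_zero (hm : PolyTime m) : PolyTime fun a => decide (m a = 0) := by
  convert hm.nat_bits.isEmpty using 2 with a
  rw [Bool.eq_iff_iff, decide_eq_true_iff, List.isEmpty_iff, ← List.length_eq_zero_iff,
    Nat.size_eq_bits_len, Nat.size_eq_zero]

theorem nat_div2 (hm : PolyTime m) : PolyTime fun a => (m a).div2 :=
  hm.nat_bits.tail.of_word_congr fun a => by rw [word_nat, Nat.div2_bits_eq_tail]

theorem nat_bodd (hm : PolyTime m) : PolyTime fun a => (m a).bodd := by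
  convert hm.nat_bits.headD (const false) using 2 with a
  rw [Nat.bodd_eq_bits_head]
  cases (m a).bits <;> rfl

/-- Zero is coded by the empty list of digits, so a digit `false` must not be put in front of it. -/
theorem nat_bit {b : α → Bool} (hb : PolyTime b) (hm : PolyTime m) :
    PolyTime fun a => Nat.bit (b a) (m a) := by
  refine ((hb.or hm.nat_eq_zero.not).ite (hb.cons hm.nat_bits)
    (const ([] : List Bool))).of_word_congr fun a => ?_
  rw [word_nat]
  by_cases h : b a = false ∧ m a = 0
  · simp [h.1, h.2]
  · rw [Nat.bits_append_bit _ _ fun h0 => by simpa [h0] using h]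
    rw [if_pos]
    by_cases h0 : m a = 0
    · have : b a = true := by simpa [h0] using h
      simp [this]
    · simp [h0]

theorem nat_horner {l : α → List Bool} (hl : PolyTime l) (hm : PolyTime m) :
    PolyTime fun a => (l a).foldl (fun n b => Nat.bit b n) (m a) := by
  refine hl.foldl_of_measure hm (f := fun _ n b => Nat.bit b n)
    ((snd.comp snd).nat_bit (fst.comp snd)) Nat.size 3 (fun c => ?_) (hm.size.mono fun a => ?_)
    (.const 1) fun a c x _ => size_bit_le x c
  · rw [size_nat]; omega
  · rw [size_nat]; omega

theorem ripple (f : Bool → Bool → Bool → Bool) (hf : PolyTime fun p : Bool × Bool × Bool =>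
    f p.1 p.2.1 p.2.2) (hm : PolyTime m) (hn : PolyTime n) :
    PolyTime fun a => ripple f (m a) (n a) := by
  have hx : PolyTime fun p : α × (ℕ × ℕ × Bool × List Bool) × Bool => p.2.1.1 :=
    fst.comp (fst.comp snd)
  have hy : PolyTime fun p : α × (ℕ × ℕ × Bool × List Bool) × Bool => p.2.1.2.1 :=
    fst.comp (snd.comp (fst.comp snd))
  have hc : PolyTime fun p : α × (ℕ × ℕ × Bool × List Bool) × Bool => p.2.1.2.2.1 :=
    fst.comp (snd.comp (snd.comp (fst.comp snd)))
  have ho : PolyTime fun p : α × (ℕ × ℕ × Bool × List Bool) × Bool => p.2.1.2.2.2 :=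
    snd.comp (snd.comp (snd.comp (fst.comp snd)))
  have hstep : PolyTime fun p : α × (ℕ × ℕ × Bool × List Bool) × Bool => rippleStep f p.2.1 :=
    hx.nat_div2.pair (hy.nat_div2.pair ((hf.comp (hx.nat_bodd.pair (hy.nat_bodd.pair hc))).pair
      ((hx.nat_bodd.xor (hy.nat_bodd.xor hc)).cons ho)))
  have hinit : PolyTime fun a => (m a, n a, false, ([] : List Bool)) :=
    hm.pair (hn.pair ((const false).pair (const [])))
  refine snd.comp (snd.comp ((hm.nat_bits.append hn.nat_bits).foldl_of_measure hinit
    (f := fun _ s _ => rippleStep f s) hstep BAP.size 1 (fun c => by omega) hinit.size (.const 3)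
    fun a c x _ => ?_))
  have hd : ∀ k : ℕ, BAP.size k.div2 ≤ BAP.size k := fun k => by
    have := size_tail_le k.bits
    rwa [← Nat.div2_bits_eq_tail] at this
  obtain ⟨x, y, c, o⟩ := c
  have := hd x
  have := hd y
  simp only [rippleStep, size_mk, size_cons, size_bool]
  omega

end PolyTime

theorem horner_natCast (l : List Bool) (n : ℕ) :
    horner l n = (l.foldl (fun n b => Nat.bit b n) n : ℕ) := by
  induction l generalizing n with
  | nil => rfl
  | cons b l ih =>
    rw [List.foldl_cons, ← ih, horner, List.foldl_cons, ← horner, Nat.bit_val]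
    push_cast
    rfl

theorem horner_neg (l : List Bool) {z : ℤ} (hz : z < 0) : horner l z < 0 := by
  induction l generalizing z with
  | nil => exact hz
  | cons b l ih =>
    rw [horner, List.foldl_cons]
    exact ih (by have := b.toNat_le; omega)

/-- The carry of addition. -/
def addCarry (a b c : Bool) : Bool := if a then b || c else b && c

/-- The borrow of subtraction. -/
def subBorrow (a b c : Bool) : Bool := if a then b && c else b || c

namespace PolyTime

variable {α β γ : Type} [Coded α] [Coded β] [Coded γ] {m n : α → ℕ}

theorem nat_add (hm : PolyTime m) (hn : PolyTime n) : PolyTime fun a => m a + n a := by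
  have hb := fst (α := Bool) (β := Bool × Bool)
  have hc := (fst (α := Bool) (β := Bool)).comp (snd (α := Bool))
  have hd := (snd (α := Bool) (β := Bool)).comp (snd (α := Bool))
  have h := ripple addCarry (hb.ite (hc.or hd) (hc.and hd)) hm hn
  convert (snd.comp h).nat_horner ((fst.comp h).ite (const 1) (const 0)) using 2 with a
  have := horner_ripple (f := addCarry) (s := 1) (by decide) (m a) (n a)
  rw [← @Nat.cast_inj ℤ, ← horner_natCast]
  push_cast at this ⊢
  simp only [one_mul] at this
  rw [← this]
  cases (BAP.ripple addCarry (m a) (n a)).1 <;> simp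

/-- A final borrow is a leading part `-1`, which makes the represented integer negative by
`horner_neg`; truncated subtraction is then `0`. Without a borrow the digits are those of the
difference. -/
theorem nat_sub (hm : PolyTime m) (hn : PolyTime n) : PolyTime fun a => m a - n a := by
  have hb := fst (α := Bool) (β := Bool × Bool)
  have hc := (fst (α := Bool) (β := Bool)).comp (snd (α := Bool))
  have hd := (snd (α := Bool) (β := Bool)).comp (snd (α := Bool))
  have h := ripple subBorrow (hb.ite (hc.and hd) (hc.or hd)) hm hn
  convert (fst.comp h).ite (const 0) ((snd.comp h).nat_horner (const 0)) using 2 with a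
  have := horner_ripple (f := subBorrow) (s := -1) (by decide) (m a) (n a)
  cases hr : (BAP.ripple subBorrow (m a) (n a)).1 with
  | false =>
    rw [hr] at this
    have h0 := horner_natCast (BAP.ripple subBorrow (m a) (n a)).2 0
    simp only [Bool.toNat_false, Nat.cast_zero, mul_zero] at this h0
    rw [h0] at this
    simp only [Bool.false_eq_true, if_false]
    omega
  | true =>
    rw [hr] at this
    have h0 := horner_neg (BAP.ripple subBorrow (m a) (n a)).2 (z := -1) (by norm_num)
    simp only [Bool.toNat_true, Nat.cast_one, mul_one] at this
    rw [this] at h0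
    simp only [if_true]
    omega

/-- Shift and add, from the most significant digit of `m a` downwards; each round lengthens the
partial product by at most the length of `n a` plus a constant. -/
theorem nat_mul (hm : PolyTime m) (hn : PolyTime n) : PolyTime fun a => m a * n a := by
  have key : ∀ (b : ℕ) (l : List Bool),
      l.reverse.foldl (fun c x => Nat.bit false c + if x then b else 0) 0 =
        l.foldr Nat.bit 0 * b := by
    intro b l
    rw [List.foldl_reverse]
    induction l with
    | nil => simp
    | cons x l ih =>
      rw [List.foldr_cons, ih, List.foldr_cons, Nat.bit_val, Nat.bit_val]
      cases x <;> simp <;> ring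
  have hbits : ∀ k : ℕ, k.bits.foldr Nat.bit 0 = k := by
    intro k
    induction k using Nat.binaryRec' with
    | zero => simp
    | bit b n hb ih => rw [Nat.bits_append_bit n b hb]; simp [ih]
  have := hm.nat_bits.reverse.foldl_of_measure (const 0)
    (f := fun a c x => Nat.bit false c + if x then n a else 0)
    ((nat_bit (const false) (fst.comp snd)).nat_add
      ((snd.comp snd).ite (hn.comp fst) (const 0))) Nat.size 3 (fun c => by rw [size_nat]; omega)
    (.const 0) (D := fun a => BAP.size (n a)) hn.size fun a c x _ => ?_
  · simpa only [key, hbits] using this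
  · have h1 := nat_size_add_le (Nat.bit false c) (if x then n a else 0)
    have h2 := size_bit_le false c
    have h3 := size_nat (n a)
    cases x
    · simp only [Bool.false_eq_true, if_false, add_zero]; omega
    · simp only [if_true] at h1 ⊢; omega

end PolyTime

/-! ### Integers -/

instance : Coded ℤ := ⟨fun z => Coded.code (z.toNat, (-z).toNat)⟩

theorem word_int (z : ℤ) : word z = word (z.toNat, (-z).toNat) := rfl

theorem size_int (z : ℤ) : size z = size (z.toNat, (-z).toNat) := rfl

namespace PolyTime

variable {α β : Type} [Coded α] [Coded β] {m n : α → ℕ} {z w : α → ℤ}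

theorem int_toNat (hz : PolyTime z) : PolyTime fun a => (z a).toNat :=
  fst.comp (hz.of_word_congr (g := fun a => ((z a).toNat, (-z a).toNat)) fun _ => rfl)

theorem int_neg_toNat (hz : PolyTime z) : PolyTime fun a => (-z a).toNat :=
  snd.comp (hz.of_word_congr (g := fun a => ((z a).toNat, (-z a).toNat)) fun _ => rfl)

/-- The two truncated differences are the positive and the negative part, hence exactly the code of
the integer. -/
theorem int_sub_nat (hm : PolyTime m) (hn : PolyTime n) : PolyTime fun a => (m a : ℤ) - n a := by
  refine ((hm.nat_sub hn).pair (hn.nat_sub hm)).of_word_congr fun a => ?_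
  have h1 : ((m a : ℤ) - n a).toNat = m a - n a := by omega
  have h2 : (-((m a : ℤ) - n a)).toNat = n a - m a := by omega
  rw [word_int, h1, h2]

theorem int_natCast (hm : PolyTime m) : PolyTime fun a => (m a : ℤ) := by
  simpa using hm.int_sub_nat (const 0)

theorem int_neg (hz : PolyTime z) : PolyTime fun a => -z a := by
  convert hz.int_neg_toNat.int_sub_nat hz.int_toNat using 2 with a
  omega

theorem int_add (hz : PolyTime z) (hw : PolyTime w) : PolyTime fun a => z a + w a := by
  convert (hz.int_toNat.nat_add hw.int_toNat).int_sub_nat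
    (hz.int_neg_toNat.nat_add hw.int_neg_toNat) using 2 with a
  omega

theorem int_mul_nat (hz : PolyTime z) (hm : PolyTime m) : PolyTime fun a => z a * m a := by
  convert (hz.int_toNat.nat_mul hm).int_sub_nat (hz.int_neg_toNat.nat_mul hm) using 2 with a
  push_cast
  rw [← sub_mul]
  congr 1
  omega

theorem int_natAbs (hz : PolyTime z) : PolyTime fun a => (z a).natAbs := by
  convert hz.int_toNat.nat_add hz.int_neg_toNat using 2 with a
  omega

theorem int_neg_test (hz : PolyTime z) : PolyTime fun a => decide (z a < 0) := by
  convert hz.int_neg_toNat.nat_eq_zero.not using 2 with a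
  rw [← decide_not, decide_eq_decide]
  omega

theorem int_eq_zero (hz : PolyTime z) : PolyTime fun a => decide (z a = 0) := by
  convert hz.int_natAbs.nat_eq_zero using 2 with a
  simp

end PolyTime

/-! ### Fractions -/

namespace Fraction

/-- The fraction `0 / 1`. -/
def zero : Fraction := ⟨0, 1, one_pos⟩

/-- The sum of two fractions. -/
def add (p q : Fraction) : Fraction :=
  ⟨p.num * q.den + q.num * p.den, p.den * q.den, Nat.mul_pos p.den_pos q.den_pos⟩

/-- The difference of two fractions. -/
def sub (p q : Fraction) : Fraction := p.add ⟨-q.num, q.den, q.den_pos⟩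

/-- The sum of a list of fractions. -/
def sum (l : List Fraction) : Fraction := l.foldl add zero

/-- The fraction with given numerator and denominator, or `0` if the denominator is `0`. -/
def ofPair (z : ℤ) (n : ℕ) : Fraction := if h : n = 0 then zero else ⟨z, n, Nat.pos_of_ne_zero h⟩

theorem toReal_zero : zero.toReal = 0 := by simp [zero, toReal]

theorem toReal_add (p q : Fraction) : (p.add q).toReal = p.toReal + q.toReal := by
  have hp : (p.den : ℝ) ≠ 0 := Nat.cast_ne_zero.2 p.den_pos.ne'
  have hq : (q.den : ℝ) ≠ 0 := Nat.cast_ne_zero.2 q.den_pos.ne'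
  simp only [toReal, add]
  push_cast
  field_simp

theorem toReal_sub (p q : Fraction) : (p.sub q).toReal = p.toReal - q.toReal := by
  rw [sub, toReal_add, sub_eq_add_neg]
  simp [toReal, neg_div]

theorem toReal_sum (l : List Fraction) : (sum l).toReal = (l.map toReal).sum := by
  have : ∀ c : Fraction, (l.foldl add c).toReal = c.toReal + (l.map toReal).sum := by
    induction l with
    | nil => simp
    | cons x l ih =>
      intro c
      rw [List.foldl_cons, ih, toReal_add, List.map_cons, List.sum_cons, add_assoc]
  rw [sum, this, toReal_zero, zero_add]

theorem toReal_eq_zero (p : Fraction) : p.toReal = 0 ↔ p.num = 0 := by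
  have hp : (p.den : ℝ) ≠ 0 := Nat.cast_ne_zero.2 p.den_pos.ne'
  simp [toReal, hp]

end Fraction

instance : Coded Fraction := ⟨fun q => Coded.code (q.num, q.den)⟩

theorem word_fraction (q : Fraction) : word q = word (q.num, q.den) := rfl

theorem size_fraction (q : Fraction) : size q = size (q.num, q.den) := rfl

namespace PolyTime

variable {α β : Type} [Coded α] [Coded β] {p q : α → Fraction}

theorem num (hq : PolyTime q) : PolyTime fun a => (q a).num :=
  fst.comp (hq.of_word_congr (g := fun a => ((q a).num, (q a).den)) fun _ => rfl)

theorem den (hq : PolyTime q) : PolyTime fun a => (q a).den :=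
  snd.comp (hq.of_word_congr (g := fun a => ((q a).num, (q a).den)) fun _ => rfl)

theorem fraction_mk {z : α → ℤ} {n : α → ℕ} (hz : PolyTime z) (hn : PolyTime n)
    (h : ∀ a, 0 < n a) : PolyTime fun a => Fraction.mk (z a) (n a) (h a) :=
  (hz.pair hn).of_word_congr fun _ => rfl

theorem fraction_ofPair {z : α → ℤ} {n : α → ℕ} (hz : PolyTime z) (hn : PolyTime n) :
    PolyTime fun a => Fraction.ofPair (z a) (n a) := by
  refine (hn.nat_eq_zero.ite (const ((0 : ℤ), 1)) (hz.pair hn)).of_word_congr fun a => ?_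
  by_cases h : n a = 0 <;> simp [Fraction.ofPair, h, Fraction.zero, word_fraction]

theorem fraction_add (hp : PolyTime p) (hq : PolyTime q) : PolyTime fun a => (p a).add (q a) :=
  ((hp.num.int_mul_nat hq.den).int_add (hq.num.int_mul_nat hp.den)).fraction_mk
    (hp.den.nat_mul hq.den) _

theorem fraction_sub (hp : PolyTime p) (hq : PolyTime q) : PolyTime fun a => (p a).sub (q a) :=
  hp.fraction_add (hq.num.int_neg.fraction_mk hq.den _)

/-- The measure is the bit length of `|num| + den`. From `|a d + c b| + b d ≤ (|a| + b) (|c| + d)`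
it follows that adding a fraction increases it by at most the measure of that fraction, so
denominators may be multiplied without cancellation. The constant `9` comes from three natural
numbers in the code, each with three symbols per bit. -/
theorem fraction_sum {l : α → List Fraction} (hl : PolyTime l) :
    PolyTime fun a => Fraction.sum (l a) := by
  have h0 (c : Fraction) : PolyBdd fun _ : α => (c.num.natAbs + c.den).size := .const _
  unfold Fraction.sum
  have hadd : PolyTime fun p : α × Fraction × Fraction => p.2.1.add p.2.2 :=
    (fst.comp snd).fraction_add (snd.comp snd)
  refine hl.foldl_of_measure (const Fraction.zero) (f := fun _ => Fraction.add) hadd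
    (fun q => (q.num.natAbs + q.den).size) 9
    (fun c => ?_) (h0 _) hl.size fun a c x hx => ?_
  · have h1 : c.num.toNat.size ≤ (c.num.natAbs + c.den).size := Nat.size_le_size (by omega)
    have h2 : (-c.num).toNat.size ≤ (c.num.natAbs + c.den).size := Nat.size_le_size (by omega)
    have h3 : c.den.size ≤ (c.num.natAbs + c.den).size := Nat.size_le_size (by omega)
    rw [size_fraction, size_mk, size_int, size_mk, size_nat, size_nat, size_nat]
    omega
  · have h1 := nat_size_mul_le (c.num.natAbs + c.den) (x.num.natAbs + x.den)
    have h2 : (c.add x).num.natAbs + (c.add x).den ≤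
        (c.num.natAbs + c.den) * (x.num.natAbs + x.den) := by
      have h := Int.natAbs_add_le (c.num * x.den) (x.num * c.den)
      rw [Int.natAbs_mul, Int.natAbs_mul, Int.natAbs_natCast, Int.natAbs_natCast] at h
      simp only [Fraction.add]
      nlinarith [Nat.zero_le (c.num.natAbs * x.num.natAbs)]
    have h3 : (x.num.natAbs + x.den).size ≤ BAP.size x := by
      have h4 : x.num.natAbs.size ≤ x.num.toNat.size + (-x.num).toNat.size := by
        rcases le_total 0 x.num with h | h
        · exact (Nat.size_le_size (by omega)).trans (Nat.le_add_right _ _)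
        · exact (Nat.size_le_size (by omega)).trans (Nat.le_add_left _ _)
      have h5 := nat_size_add_le x.num.natAbs x.den
      rw [size_fraction, size_mk, size_int, size_mk, size_nat, size_nat, size_nat]
      omega
    have h4 := size_lt_of_mem hx
    have h5 := Nat.size_le_size h2
    omega

end PolyTime

/-! ### Reading the input -/

/-- Cut a word at the occurrences of a symbol. -/
def cut (c : Sym) (w : List Sym) : List (List Sym) :=
  w.foldr (fun s t => if s = c then [] :: t else (s :: t.headD []) :: t.tail) []

theorem cut_append_cons {c : Sym} {u : List Sym} (hu : c ∉ u) (v : List Sym) :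
    cut c (u ++ c :: v) = u :: cut c v := by
  induction u with
  | nil => simp [cut]
  | cons s u ih =>
    simp only [List.mem_cons, not_or] at hu
    have := ih hu.2
    simp only [cut, List.cons_append, List.foldr_cons] at this ⊢
    rw [this, if_neg (Ne.symm hu.1)]
    rfl

/-- The empty word has no pieces at all, and there the default `[]` is the right value. -/
theorem cut_headD {c : Sym} {u : List Sym} (hu : c ∉ u) : (cut c u).headD [] = u := by
  induction u with
  | nil => rfl
  | cons s u ih =>
    simp only [List.mem_cons, not_or] at hu
    have := ih hu.2
    simp only [cut, List.foldr_cons] at this ⊢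
    rw [if_neg (Ne.symm hu.1), this]
    rfl

/-- The worst symbol is one that opens a new piece: it costs three for the symbol and three for the
piece. -/
theorem size_cut_le (c : Sym) (w : List Sym) : size (cut c w) ≤ 6 * w.length + 2 := by
  induction w with
  | nil => simp [cut]
  | cons s w ih =>
    simp only [cut, List.foldr_cons] at ih ⊢
    split
    · simp only [size_cons, size_nil, List.length_cons]; omega
    · generalize List.foldr _ [] w = t at ih ⊢
      cases t <;> simp only [size_cons, size_nil, List.length_cons, List.headD_nil, List.tail_nil,
        List.headD_cons, List.tail_cons, size_sym] at ih ⊢ <;> omega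

/-- The natural number with given binary digits. -/
def parseNat (u : List Sym) : ℕ :=
  (u.map fun s => decide (s = .one)).reverse.foldl (fun n b => Nat.bit b n) 0

theorem parseNat_encodeNat (n : ℕ) : parseNat (encodeNat n) = n := by
  have h : ∀ l : List Bool, (l.map fun b => if b then Sym.one else Sym.zero).map
      (fun s => decide (s = .one)) = l := by
    intro l
    induction l with
    | nil => rfl
    | cons b l ih => rw [List.map_cons, List.map_cons, ih]; cases b <;> rfl
  rw [parseNat, encodeNat, h, List.foldl_reverse]
  induction n using Nat.binaryRec' with
  | zero => simp
  | bit b n hb ih => rw [Nat.bits_append_bit n b hb]; simp [ih]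

/-- The integer with given sign and binary digits. -/
def parseInt (u : List Sym) : ℤ :=
  if u.headD .zero = .minus then -(parseNat u.tail : ℤ) else parseNat u

theorem parseInt_encodeInt (z : ℤ) : parseInt (encodeInt z) = z := by
  unfold encodeInt
  split
  · simp only [List.cons_append, List.nil_append, parseInt, List.headD_cons, if_true,
      List.tail_cons, parseNat_encodeNat]
    omega
  · have h : (encodeNat z.natAbs).headD .zero ≠ .minus := by
      intro h
      cases hc : encodeNat z.natAbs with
      | nil => simp [hc] at h
      | cons s l =>
        have := mem_encodeNat (a := z.natAbs) (s := s) (by simp [hc])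
        rw [hc, List.headD_cons] at h
        simp [h] at this
    rw [List.nil_append, parseInt, if_neg h, parseNat_encodeNat]
    omega

/-- The code of a fraction without the separator at the end. -/
def fractionToken (q : Fraction) : List Sym := encodeInt q.num ++ Sym.slash :: encodeNat q.den

theorem encodeFraction_eq (q : Fraction) : encodeFraction q = fractionToken q ++ [.sep] := by
  simp [encodeFraction, fractionToken]

/-- The fraction with a given token. -/
def parseFraction (u : List Sym) : Fraction :=
  .ofPair (parseInt ((cut .slash u).headD [])) (parseNat ((cut .slash u).tail.headD []))

theorem parseFraction_fractionToken (q : Fraction) : parseFraction (fractionToken q) = q := by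
  have hi : Sym.slash ∉ encodeInt q.num := fun h => by simpa using mem_encodeInt h
  have hn : Sym.slash ∉ encodeNat q.den := fun h => by simpa using mem_encodeNat h
  rw [parseFraction, fractionToken, cut_append_cons hi, List.headD_cons, List.tail_cons,
    cut_headD hn, parseInt_encodeInt, parseNat_encodeNat, Fraction.ofPair,
    dif_neg q.den_pos.ne']

theorem cut_flatMap_encodeFraction (l : List Fraction) :
    (cut .sep (l.flatMap encodeFraction)).map parseFraction = l := by
  induction l with
  | nil => rfl
  | cons q l ih =>
    have hq : Sym.sep ∉ fractionToken q := by
      intro h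
      rcases List.mem_append.1 h with h | h
      · simpa using mem_encodeInt h
      · rcases List.mem_cons.1 h with h | h
        · simp at h
        · simpa using mem_encodeNat h
    rw [List.flatMap_cons, encodeFraction_eq, List.append_assoc, List.singleton_append,
      cut_append_cons hq, List.map_cons, ih, parseFraction_fractionToken]

/-- The entries of a cost array in lexicographic order. -/
def entries {m n : ℕ} (Q : CostArray m n Fraction) : List Fraction :=
  (List.finRange m).flatMap fun i => (List.finRange m).flatMap fun j =>
    (List.finRange n).flatMap fun k => (List.finRange n).map fun l => Q i j k l

theorem encodeCostArray_eq {m n : ℕ} (Q : CostArray m n Fraction) :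
    encodeCostArray Q = (entries Q).flatMap encodeFraction := by
  simp only [encodeCostArray, entries, List.flatMap_assoc, List.flatMap_map]

/-- The sizes and the list of entries of an input word. -/
def parseInput (w : List Sym) : (Unary × Unary) × List Fraction :=
  ((⟨((cut .sep w).headD []).length⟩, ⟨((cut .sep w).tail.headD []).length⟩),
    (cut .sep w).tail.tail.map parseFraction)

theorem parseInput_encodeInput (I : Input) :
    parseInput (encodeInput I) = ((⟨I.m⟩, ⟨I.n⟩), entries I.entry) := by
  have hr : ∀ a : ℕ, Sym.sep ∉ List.replicate a Sym.one := fun a ha => by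
    simpa using List.eq_of_mem_replicate ha
  rw [parseInput, encodeInput, cut_append_cons (hr _), cut_append_cons (hr _),
    encodeCostArray_eq]
  simp [cut_flatMap_encodeFraction]

/-! ### Parsing in polynomial time -/

namespace PolyTime

variable {α β : Type} [Coded α] [Coded β] {w : α → List Sym}

theorem cut (c : Sym) (hw : PolyTime w) : PolyTime fun a => cut c (w a) := by
  have hh := ((snd.comp snd).headD (const ([] : List Sym)) :
    PolyTime fun p : α × Sym × List (List Sym) => p.2.2.headD [])
  have hf := ((sym_test fun s => decide (s = c)).comp (fst.comp snd)).ite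
    ((const ([] : List Sym)).cons (snd.comp snd))
    (((fst.comp snd).cons hh).cons
      ((snd.comp snd).tail : PolyTime fun p : α × Sym × List (List Sym) => p.2.2.tail))
  simp only [decide_eq_true_eq] at hf
  refine hw.foldr (const [])
    (f := fun _ s t => if s = c then [] :: t else (s :: t.headD []) :: t.tail) hf
    (((PolyBdd.const 6).mul hw.size).add (.const 2)) fun a t ht => (size_cut_le c t).trans ?_
  have := length_add_two_le_size t
  have := size_le_of_suffix ht
  omega

theorem parseNat (hw : PolyTime w) : PolyTime fun a => parseNat (w a) := by
  have h : PolyTime fun p : α × Sym => decide (p.2 = .one) :=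
    (sym_test fun s => decide (s = .one)).comp snd
  unfold BAP.parseNat
  exact (hw.map (g := fun _ s => decide (s = Sym.one)) h).reverse.nat_horner (const 0)

theorem parseInt (hw : PolyTime w) : PolyTime fun a => parseInt (w a) := by
  have := ((sym_test fun s => decide (s = .minus)).comp (hw.headD (const .zero))).ite
    hw.tail.parseNat.int_natCast.int_neg hw.parseNat.int_natCast
  simpa only [decide_eq_true_eq, BAP.parseInt] using this

theorem parseFraction (hw : PolyTime w) : PolyTime fun a => parseFraction (w a) := by
  unfold BAP.parseFraction
  exact ((hw.cut .slash).headD (const [])).parseInt.fraction_ofPair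
    ((hw.cut .slash).tail.headD (const [])).parseNat

theorem parseInput (hw : PolyTime w) : PolyTime fun a => parseInput (w a) :=
  (((hw.cut .sep).headD (const [])).length.pair
    ((hw.cut .sep).tail.headD (const [])).length).pair
    ((hw.cut .sep).tail.tail.map (g := fun _ u => BAP.parseFraction u) (parseFraction snd))

/-! ### Writing the output -/

theorem encodeNat {n : α → ℕ} (hn : PolyTime n) : PolyTime fun a => encodeNat (n a) := by
  have h : PolyTime fun p : α × Bool => if p.2 then Sym.one else Sym.zero :=
    snd.ite (const Sym.one) (const Sym.zero)
  unfold BAP.encodeNat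
  exact hn.nat_bits.map (g := fun _ b => if b then Sym.one else Sym.zero) h

theorem encodeInt {z : α → ℤ} (hz : PolyTime z) : PolyTime fun a => encodeInt (z a) := by
  have := (hz.int_neg_test.ite (const [Sym.minus]) (const [])).append hz.int_natAbs.encodeNat
  simpa only [decide_eq_true_eq, BAP.encodeInt] using this

theorem encodeFraction {q : α → Fraction} (hq : PolyTime q) :
    PolyTime fun a => encodeFraction (q a) :=
  hq.num.encodeInt.append ((const Sym.slash).cons (hq.den.encodeNat.append (const [Sym.sep])))

/-! ### Loops over indices -/

theorem range_all {u : α → Unary} {g : α → ℕ → Bool} (hu : PolyTime u)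
    (hg : PolyTime fun p : α × Unary => g p.1 p.2.val) :
    PolyTime fun a => (List.range (u a).val).all (g a) := by
  have := hu.unary_range.all (g := fun a v => g a v.val) hg
  simpa only [List.all_map, Function.comp_def] using this

theorem range_map {u : α → Unary} {g : α → ℕ → β} (hu : PolyTime u)
    (hg : PolyTime fun p : α × Unary => g p.1 p.2.val) :
    PolyTime fun a => (List.range (u a).val).map (g a) := by
  have := hu.unary_range.map (g := fun a v => g a v.val) hg
  simpa only [List.map_map, Function.comp_def] using this

theorem range_flatMap {u : α → Unary} {g : α → ℕ → List β} (hu : PolyTime u)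
    (hg : PolyTime fun p : α × Unary => g p.1 p.2.val) :
    PolyTime fun a => (List.range (u a).val).flatMap (g a) := by
  have := hu.unary_range.flatMap (g := fun a v => g a v.val) hg
  simpa only [List.flatMap_map, Function.comp_def] using this

end PolyTime

/-! ### The algorithm -/

/-- The sizes and the entries of a cost array. -/
abbrev Table : Type := (Unary × Unary) × List Fraction

namespace Table

/-- The number of rows of the first matrix. -/
def m (Q : Table) : ℕ := Q.1.1.val

/-- The number of rows of the second matrix. -/
def n (Q : Table) : ℕ := Q.1.2.val

/-- An entry of the cost array. -/
def get (Q : Table) (i j k l : ℕ) : Fraction :=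
  Q.2.getD (((i * Q.m + j) * Q.n + k) * Q.n + l) .zero

/-- The alternating sum of the entries with first indices `i` or `0` and `j` or `0`. -/
def diff (Q : Table) (i j k l : ℕ) : Fraction :=
  ((Q.get i j k l).add (Q.get 0 0 k l)).sub ((Q.get 0 j k l).add (Q.get i 0 k l))

/-- The alternating sum of the sixteen entries each of whose indices is `0` or the given one. -/
def diffDiff (Q : Table) (i j k l : ℕ) : Fraction :=
  ((Q.diff i j k l).add (Q.diff i j 0 0)).sub ((Q.diff i j 0 l).add (Q.diff i j k 0))

/-- Whether all alternating sums vanish. -/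
def test (Q : Table) : Bool :=
  (List.range Q.m).all fun i => (List.range Q.m).all fun j => (List.range Q.n).all fun k =>
    (List.range Q.n).all fun l => decide ((Q.diffDiff i j k l).num = 0)

/-- The entries of the first matrix of the linearization. -/
def fst (Q : Table) (i j : ℕ) : Fraction :=
  .sum ((List.range Q.n).map fun k => Q.get i j k k)

/-- The entries of the second matrix of the linearization. -/
def snd (Q : Table) (k l : ℕ) : Fraction :=
  .sum ((List.range Q.m).map fun i => (Q.get i i k l).sub (Q.get i i k k))

/-- The answer as a word. -/
def answer (Q : Table) : List Sym :=
  if Q.test then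
    Sym.yes :: (((List.range Q.m).flatMap fun i => (List.range Q.m).flatMap fun j =>
      encodeFraction (Q.fst i j)) ++ ((List.range Q.n).flatMap fun k =>
      (List.range Q.n).flatMap fun l => encodeFraction (Q.snd k l)))
  else [Sym.no]

end Table

/-! ### The algorithm runs in polynomial time -/

namespace PolyTime

variable {α : Type} [Coded α] {Q : α → Table} {i j k l : α → Unary}

theorem table_m (hQ : PolyTime Q) : PolyTime fun a => (Q a).1.1 := fst.comp (fst.comp hQ)

theorem table_n (hQ : PolyTime Q) : PolyTime fun a => (Q a).1.2 := snd.comp (fst.comp hQ)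

theorem table_get (hQ : PolyTime Q) (hi : PolyTime i) (hj : PolyTime j) (hk : PolyTime k)
    (hl : PolyTime l) : PolyTime fun a => (Q a).get (i a).val (j a).val (k a).val (l a).val :=
  (snd.comp hQ).getD ((((((hi.unary_mul hQ.table_m).unary_add hj).unary_mul hQ.table_n).unary_add
    hk).unary_mul hQ.table_n).unary_add hl) (const Fraction.zero)

theorem table_diff (hQ : PolyTime Q) (hi : PolyTime i) (hj : PolyTime j) (hk : PolyTime k)
    (hl : PolyTime l) : PolyTime fun a => (Q a).diff (i a).val (j a).val (k a).val (l a).val := by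
  have h0 : PolyTime fun _ : α => Unary.mk 0 := const _
  exact ((hQ.table_get hi hj hk hl).fraction_add (hQ.table_get h0 h0 hk hl)).fraction_sub
    ((hQ.table_get h0 hj hk hl).fraction_add (hQ.table_get hi h0 hk hl))

theorem table_diffDiff (hQ : PolyTime Q) (hi : PolyTime i) (hj : PolyTime j) (hk : PolyTime k)
    (hl : PolyTime l) :
    PolyTime fun a => (Q a).diffDiff (i a).val (j a).val (k a).val (l a).val := by
  have h0 : PolyTime fun _ : α => Unary.mk 0 := const _
  exact ((hQ.table_diff hi hj hk hl).fraction_add (hQ.table_diff hi hj h0 h0)).fraction_sub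
    ((hQ.table_diff hi hj h0 hl).fraction_add (hQ.table_diff hi hj hk h0))

theorem table_test (hQ : PolyTime Q) : PolyTime fun a => (Q a).test := by
  have h1 : PolyTime fun p : α × Unary => Q p.1 := hQ.comp fst
  have h2 : PolyTime fun p : (α × Unary) × Unary => Q p.1.1 := h1.comp fst
  have h3 : PolyTime fun p : ((α × Unary) × Unary) × Unary => Q p.1.1.1 := h2.comp fst
  have h4 : PolyTime fun p : (((α × Unary) × Unary) × Unary) × Unary => Q p.1.1.1.1 := h3.comp fst
  exact hQ.table_m.range_all (h1.table_m.range_all (h2.table_n.range_all (h3.table_n.range_all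
    (h4.table_diffDiff (snd.comp (fst.comp (fst.comp fst))) (snd.comp (fst.comp fst))
      (snd.comp fst) snd).num.int_eq_zero)))

theorem table_fst (hQ : PolyTime Q) (hi : PolyTime i) (hj : PolyTime j) :
    PolyTime fun a => (Q a).fst (i a).val (j a).val :=
  (hQ.table_n.range_map (g := fun a k => (Q a).get (i a).val (j a).val k k)
    ((hQ.comp fst).table_get (hi.comp fst) (hj.comp fst) snd snd)).fraction_sum

theorem table_snd (hQ : PolyTime Q) (hk : PolyTime k) (hl : PolyTime l) :
    PolyTime fun a => (Q a).snd (k a).val (l a).val :=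
  (hQ.table_m.range_map
    (g := fun a i => ((Q a).get i i (k a).val (l a).val).sub ((Q a).get i i (k a).val (k a).val))
    (((hQ.comp fst).table_get snd snd (hk.comp fst) (hl.comp fst)).fraction_sub
      ((hQ.comp fst).table_get snd snd (hk.comp fst) (hk.comp fst)))).fraction_sum

theorem table_answer (hQ : PolyTime Q) : PolyTime fun a => (Q a).answer := by
  have h1 : PolyTime fun p : α × Unary => Q p.1 := hQ.comp fst
  have h2 : PolyTime fun p : (α × Unary) × Unary => Q p.1.1 := h1.comp fst
  exact hQ.table_test.ite ((const Sym.yes).cons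
    ((hQ.table_m.range_flatMap (h1.table_m.range_flatMap
      (h2.table_fst (snd.comp fst) snd).encodeFraction)).append
    (hQ.table_n.range_flatMap (h1.table_n.range_flatMap
      (h2.table_snd (snd.comp fst) snd).encodeFraction)))) (const [Sym.no])

end PolyTime

/-! ### Machines for functions on words -/

namespace Cmd

/-- Replace the word on `left` by its code on `main`. -/
def load : Cmd :=
  .seq (pour .left .right) <| .seq (.push .main .zero) <| .seq (.push .main .zero) <|
    .loop .right Option.isSome (.seq (.move .right .main) <| .seq (.push .main .zero)
      (.push .main .one))

/-- Replace the code of a word on `main` by the word on `left`. -/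
def unload : Cmd :=
  .seq (.loop .main (· == some .one) (.seq (.drop .main) <| .seq (.drop .main)
    (.move .main .right))) <| .seq (.drop .main) <| .seq (.drop .main) (pour .right .left)

end Cmd

theorem size_symList (w : List Sym) : size w = 3 * w.length + 2 := by
  induction w with
  | nil => rfl
  | cons s w ih => simp only [size_cons, List.length_cons, ih, size_sym]; ring

namespace Within

theorem load (w : List Sym) :
    Within Cmd.load (.mk [] w [] []) (6 * w.length + 4) (.mk (word w) [] [] []) := by
  have key : ∀ u v : List Sym, Within
      (.loop .right Option.isSome (.seq (.move .right .main) <| .seq (.push .main .zero)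
        (.push .main .one))) (.mk (word v) [] u []) (4 * u.length + 1)
      (.mk (word (u.reverse ++ v)) [] [] []) := by
    intro u
    induction u with
    | nil => intro v; exact loop_done rfl
    | cons s u ih =>
      intro v
      refine (loop_step rfl (seq (move rfl) (seq push push)) (T' := 4 * u.length + 1) ?_).mono ?_
      · simpa [word_cons, word_sym] using ih (s :: v)
      · simp only [List.length_cons]; omega
  have h := key w.reverse []
  rw [List.length_reverse, List.reverse_reverse, List.append_nil] at h
  refine (seq (pour_left_right w [] [] []) (seq push (seq push
    (T' := 4 * w.length + 1) ?_))).mono (by omega)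
  simpa [word_nil] using h

theorem unload (w : List Sym) :
    Within Cmd.unload (.mk (word w) [] [] []) (6 * w.length + 4) (.mk [] w [] []) := by
  have key : ∀ v u : List Sym, Within
      (.loop .main (· == some .one) (.seq (.drop .main) <| .seq (.drop .main)
        (.move .main .right))) (.mk (word v) [] u []) (4 * v.length + 1)
      (.mk (word ([] : List Sym)) [] (v.reverse ++ u) []) := by
    intro v
    induction v with
    | nil => intro u; exact loop_done rfl
    | cons s v ih =>
      intro u
      refine (loop_step rfl (seq drop (seq drop (move (s := s) ?_))) (T' := 4 * v.length + 1)
        ?_).mono ?_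
      · simp [word_cons, word_sym]
      · simpa [word_cons, word_sym] using ih (s :: u)
      · simp only [List.length_cons]; omega
  have h := pour_right_left w.reverse [] [] []
  rw [List.length_reverse, List.reverse_reverse, List.append_nil] at h
  refine (seq (key w []) (seq drop (seq drop (T' := 2 * w.length + 1) ?_))).mono (by omega)
  simpa [word_nil] using h

end Within

/-- A polynomial-time function on words is computed by a machine in polynomial time. -/
theorem PolyTime.tm2ComputableInPolyTime {f : List Sym → List Sym} (hf : PolyTime f)
    {α β : Type} {ea : α → List Sym} {eb : β → List Sym} {g : α → β}
    (h : ∀ a, f (ea a) = eb (g a)) :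
    Nonempty (Turing.TM2ComputableInPolyTime ea eb g) := by
  obtain ⟨c, p, hs, hc⟩ := hf.exists_within
  -- The code of `w` has length `3 * w.length + 2`, where `p` is evaluated. One copy of that value
  -- pays for `c`; the other two pay for unloading, because `3 * (f w).length + 2` is bounded by the
  -- same value.
  have hrun : ∀ w : List Sym, Within (.seq .load (.seq c .unload)) (.mk [] w [] [])
      ((6 * Polynomial.X + 4 + (3 * p.comp (3 * Polynomial.X + 2) + 4)).eval w.length)
      (.mk [] (f w) [] []) := by
    intro w
    have h1 := hc w []
    rw [List.append_nil, List.append_nil] at h1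
    have h2 := hs w
    have h3 := size_symList (f w)
    refine ((Within.load w).seq (h1.seq (Within.unload (f w)))).mono ?_
    rw [size_symList w] at h2 ⊢
    simp only [Polynomial.eval_add, Polynomial.eval_mul, Polynomial.eval_comp, Polynomial.eval_X,
      Polynomial.eval_ofNat]
    omega
  refine ⟨⟨⟨(Cmd.seq .load (.seq c .unload)).machine, Equiv.refl Sym, Equiv.refl Sym⟩,
    6 * Polynomial.X + 4 + (3 * p.comp (3 * Polynomial.X + 2) + 4), fun a => Classical.choice ?_⟩⟩
  obtain ⟨t, ht, hr⟩ := hrun (ea a)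
  rw [h] at hr
  have hid : ∀ w : List Sym, List.map (Equiv.refl Sym).invFun w = w := fun w => List.map_id w
  erw [hid, hid]
  exact hr.outputsInTime ht

/-! ### Linearizable cost arrays -/

section linearization

variable {m n : ℕ}

/-- The alternating sum of the entries of `c` at the rows `i`, `z` and the columns `j`, `z`. -/
def delta (z : Fin m) (c : Fin m → Fin m → ℝ) (i j : Fin m) : ℝ :=
  (c i j + c z z) - (c z j + c i z)

/-- If all alternating sums vanish, then all assignments have the same cost. -/
theorem sum_eq_of_delta_eq_zero {z : Fin m} {c : Fin m → Fin m → ℝ}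
    (hc : ∀ i j, delta z c i j = 0) {x : Matrix (Fin m) (Fin m) ℝ} (hx : IsAssignment x) :
    ∑ i, ∑ j, c i j * x i j = ∑ i, c i i := by
  -- The cost splits into a column term and a row term, whose totals do not depend on the
  -- assignment.
  have h : ∀ i j, c i j = c z j + (c i z - c z z) := fun i j => by
    have := hc i j
    unfold delta at this
    linarith
  have h1 : ∑ i, ∑ j, c z j * x i j = ∑ j, c z j := by
    rw [Finset.sum_comm]
    exact Finset.sum_congr rfl fun j _ => by rw [← Finset.mul_sum, hx.col_sum, mul_one]
  have h2 : ∑ i, ∑ j, (c i z - c z z) * x i j = ∑ i, (c i z - c z z) :=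
    Finset.sum_congr rfl fun i _ => by rw [← Finset.mul_sum, hx.row_sum, mul_one]
  calc ∑ i, ∑ j, c i j * x i j
      = ∑ i, ∑ j, (c z j * x i j + (c i z - c z z) * x i j) :=
        Finset.sum_congr rfl fun i _ => Finset.sum_congr rfl fun j _ => by rw [h i j]; ring
    _ = ∑ i, (c z i + (c i z - c z z)) := by
        simp only [Finset.sum_add_distrib, h1, h2]
    _ = ∑ i, c i i := Finset.sum_congr rfl fun i _ => (h i i).symm

/-- The assignment of a permutation. -/
def permAssignment (σ : Equiv.Perm (Fin m)) : Matrix (Fin m) (Fin m) ℝ :=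
  fun i j => if σ i = j then 1 else 0

theorem isAssignment_perm (σ : Equiv.Perm (Fin m)) : IsAssignment (permAssignment σ) where
  zero_or_one i j := by unfold permAssignment; split <;> simp
  row_sum i := by simp [permAssignment]
  col_sum j := by simp [permAssignment, ← Equiv.eq_symm_apply]

theorem sum_mul_permAssignment (c : Fin m → Fin m → ℝ) (σ : Equiv.Perm (Fin m)) :
    ∑ i, ∑ j, c i j * permAssignment σ i j = ∑ i, c i (σ i) := by
  simp [permAssignment]

/-- Every alternating sum is the difference of the costs of two assignments. -/
theorem exists_assignments_sub_eq_delta (z i j : Fin m) :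
    ∃ x x' : Matrix (Fin m) (Fin m) ℝ, IsAssignment x ∧ IsAssignment x' ∧
      ∀ c : Fin m → Fin m → ℝ,
        ∑ a, ∑ b, c a b * x a b - ∑ a, ∑ b, c a b * x' a b = delta z c i j := by
  -- If `i = z` or `j = z`, the alternating sum is identically zero and any assignment may be
  -- compared with itself.
  by_cases hi : i = z
  · exact ⟨_, _, isAssignment_perm 1, isAssignment_perm 1, fun c => by
      subst hi; unfold delta; ring⟩
  by_cases hj : j = z
  · exact ⟨_, _, isAssignment_perm 1, isAssignment_perm 1, fun c => by
      subst hj; unfold delta; ring⟩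
  -- The two permutations agree outside `z` and `i`. The first sends `z` to `z` and `i` to `j`, the
  -- second sends `z` to `j` and `i` to `z`. The case `i = j` needs no separate treatment.
  refine ⟨_, _, isAssignment_perm (Equiv.swap i j),
    isAssignment_perm (Equiv.swap i j * Equiv.swap z i), fun c => ?_⟩
  rw [sum_mul_permAssignment, sum_mul_permAssignment, ← Finset.sum_sub_distrib,
    Fintype.sum_eq_add z i (Ne.symm hi) fun a ha => by
      rw [Equiv.Perm.mul_apply, Equiv.swap_apply_of_ne_of_ne ha.1 ha.2, sub_self]]
  have h1 : Equiv.swap i j z = z := Equiv.swap_apply_of_ne_of_ne (Ne.symm hi) (Ne.symm hj)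
  simp only [Equiv.Perm.mul_apply, Equiv.swap_apply_left, Equiv.swap_apply_right, h1, delta]
  ring

/-- The double alternating sums of a cost array. -/
def deltaDelta (z : Fin m) (z' : Fin n) (Q : CostArray m n ℝ) (i j : Fin m) (k l : Fin n) : ℝ :=
  delta z' (fun k l => delta z (fun i j => Q i j k l) i j) k l

theorem sum_mul_mul (Q : CostArray m n ℝ) (x : Matrix (Fin m) (Fin m) ℝ)
    (y : Matrix (Fin n) (Fin n) ℝ) :
    ∑ i, ∑ j, ∑ k, ∑ l, Q i j k l * x i j * y k l =
      ∑ i, ∑ j, (∑ k, ∑ l, Q i j k l * y k l) * x i j := by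
  simp only [Finset.sum_mul]
  refine Finset.sum_congr rfl fun i _ => Finset.sum_congr rfl fun j _ =>
    Finset.sum_congr rfl fun k _ => Finset.sum_congr rfl fun l _ => by ring

theorem sum_rotate {ι κ μ : Type} [Fintype ι] [Fintype κ] [Fintype μ] (F : ι → κ → μ → ℝ) :
    ∑ i, ∑ k, ∑ l, F i k l = ∑ k, ∑ l, ∑ i, F i k l := by
  rw [Finset.sum_comm]
  exact Finset.sum_congr rfl fun k _ => Finset.sum_comm

theorem sum_mul_mul' (Q : CostArray m n ℝ) (x : Matrix (Fin m) (Fin m) ℝ)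
    (y : Matrix (Fin n) (Fin n) ℝ) :
    ∑ i, ∑ j, ∑ k, ∑ l, Q i j k l * x i j * y k l =
      ∑ k, ∑ l, (∑ i, ∑ j, Q i j k l * x i j) * y k l := by
  simp only [Finset.sum_mul]
  exact (Finset.sum_congr rfl fun i _ => sum_rotate _).trans (sum_rotate _)

/-- Evaluate the linearization at the four pairs formed from `x, x'` and `y, y'`. In the alternating
sum the terms of `A` and `B` cancel, while the bilinear side becomes the double alternating sum of
`Q`. -/
theorem Linearizable.deltaDelta_eq_zero {Q : CostArray m n ℝ} (hQ : Linearizable Q) (z : Fin m)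
    (z' : Fin n) (i j : Fin m) (k l : Fin n) : deltaDelta z z' Q i j k l = 0 := by
  obtain ⟨A, B, hAB⟩ := hQ
  obtain ⟨x, x', hx, hx', hxd⟩ := exists_assignments_sub_eq_delta z i j
  obtain ⟨y, y', hy, hy', hyd⟩ := exists_assignments_sub_eq_delta z' k l
  have h1 := hAB x y hx hy
  have h2 := hAB x y' hx hy'
  have h3 := hAB x' y hx' hy
  have h4 := hAB x' y' hx' hy'
  rw [sum_mul_mul] at h1 h2 h3 h4
  have h5 := hxd fun i j => ∑ k, ∑ l, Q i j k l * y k l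
  have h6 := hxd fun i j => ∑ k, ∑ l, Q i j k l * y' k l
  have h7 := hyd (Q i j)
  have h8 := hyd (Q z z)
  have h9 := hyd (Q z j)
  have h10 := hyd (Q i z)
  simp only [delta, deltaDelta] at *
  linarith

/-- Fix `x`, and let `C_x` be the matrix of the costs that `x` incurs for each `(k, l)`. The
hypothesis makes the alternating sums of `C_x` independent of `x`, so those of `C_x - C_id` vanish
and every `y` has the same cost under it as the identity. This is `Q(x, y) - Q(id, y) = Q(x, id) -
Q(id, id)`. The constant `Q(id, id)` is absorbed into `B`, spread over its rows: each row sum of `y`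
is `1`. -/
theorem isLinearization_of_deltaDelta_eq_zero {z : Fin m} {z' : Fin n} {Q : CostArray m n ℝ}
    (hQ : ∀ i j k l, deltaDelta z z' Q i j k l = 0) :
    IsLinearization Q (fun i j => ∑ k, Q i j k k) (fun k l => ∑ i, (Q i i k l - Q i i k k)) := by
  intro x y hx hy
  have h1 : ∀ k l, delta z' (fun k l => ∑ i, ∑ j, Q i j k l * x i j - ∑ i, Q i i k l) k l = 0 := by
    intro k l
    -- The two alternating sums commute, so the one over `(i, j)` can be taken last.
    have h := sum_eq_of_delta_eq_zero (z := z) (c := fun i j => delta z' (Q i j) k l)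
      (fun i j => by
        have := hQ i j k l
        simp only [deltaDelta, delta] at this ⊢
        linarith) hx
    simp only [delta, add_mul, sub_mul, Finset.sum_add_distrib, Finset.sum_sub_distrib] at h ⊢
    linarith
  have h2 := sum_eq_of_delta_eq_zero h1 hy
  have h3 : ∑ k, ∑ l, (∑ i, Q i i k k) * y k l = ∑ k, ∑ i, Q i i k k :=
    Finset.sum_congr rfl fun k _ => by rw [← Finset.mul_sum, hy.row_sum, mul_one]
  have h4 : ∑ i, ∑ j, (∑ k, Q i j k k) * x i j = ∑ k, ∑ i, ∑ j, Q i j k k * x i j := by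
    simp only [Finset.sum_mul]
    exact (sum_rotate fun k i j => Q i j k k * x i j).symm
  rw [sum_mul_mul']
  simp only [sub_mul, Finset.sum_sub_distrib] at h2 ⊢
  linarith

end linearization

/-! ### Correctness of the algorithm -/

/-- In a concatenation of blocks of equal length `c`, position `i * c + r` is position `r` of block
`i`. Used three times, this decodes the lexicographic order of the four indices. -/
theorem getD_flatMap_finRange {α : Type} {m c : ℕ} {g : Fin m → List α}
    (hg : ∀ i, (g i).length = c) (i : Fin m) {r : ℕ} (hr : r < c) (d : α) :
    ((List.finRange m).flatMap g).getD (i * c + r) d = (g i).getD r d := by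
  induction m with
  | zero => exact i.elim0
  | succ m ih =>
    rw [List.finRange_succ, List.flatMap_cons, List.flatMap_map]
    refine Fin.cases ?_ (fun i => ?_) i
    · rw [Fin.val_zero, zero_mul, zero_add, List.getD_append _ _ _ _ (by rw [hg]; exact hr)]
    · rw [List.getD_append_right _ _ _ _ (by rw [hg, Fin.val_succ]; nlinarith), hg, Fin.val_succ,
        ← ih (g := fun i => g i.succ) (fun i => hg _)]
      congr 1
      rw [add_mul, one_mul]
      omega

theorem getD_map_finRange {α : Type} {m : ℕ} (g : Fin m → α) (i : Fin m) (d : α) :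
    ((List.finRange m).map g).getD i d = g i := by
  simp [List.getD_eq_getElem?_getD]

namespace Input

variable (I : Input)

/-- The table of an input. -/
def table : Table := ((⟨I.m⟩, ⟨I.n⟩), entries I.entry)

theorem table_get (i j : Fin I.m) (k l : Fin I.n) : I.table.get i j k l = I.entry i j k l := by
  have hlen : ∀ (s c : ℕ) (g : Fin s → List Fraction), (∀ i, (g i).length = c) →
      ((List.finRange s).flatMap g).length = s * c := by
    intro s c g hg
    simp [List.length_flatMap, hg]
  have e : ((i * I.m + j) * I.n + k) * I.n + l =
      (i : ℕ) * (I.m * (I.n * I.n)) + (j * (I.n * I.n) + (k * I.n + l)) := by ring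
  have h1 : (k : ℕ) * I.n + l < I.n * I.n := by nlinarith [k.isLt, l.isLt]
  have h2 : (j : ℕ) * (I.n * I.n) + (k * I.n + l) < I.m * (I.n * I.n) := by
    nlinarith [j.isLt]
  change (entries I.entry).getD (((i * I.m + j) * I.n + k) * I.n + l) Fraction.zero = _
  rw [e, entries, getD_flatMap_finRange (fun i => ?_) i h2,
    getD_flatMap_finRange (fun j => ?_) j h1,
    getD_flatMap_finRange (fun k => ?_) k l.isLt, getD_map_finRange]
  · simp
  · exact hlen _ _ _ fun k => by simp
  · exact hlen _ _ _ fun j => hlen _ _ _ fun k => by simp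

/-- The answer for an input. -/
def answer : Answer I.m I.n :=
  if I.table.test then some (fun i j => I.table.fst i j, fun k l => I.table.snd k l) else none

theorem encodeMatrix_eq {s : ℕ} (g : ℕ → ℕ → Fraction) :
    encodeMatrix (fun i j : Fin s => g i j) =
      (List.range s).flatMap fun i => (List.range s).flatMap fun j => encodeFraction (g i j) := by
  change ((List.finRange s).flatMap fun i : Fin s => (List.finRange s).flatMap fun j : Fin s =>
    encodeFraction (g i j)) = _
  rw [← List.map_coe_finRange_eq_range]
  simp only [List.flatMap_map]

theorem encodeAnswer_answer : encodeAnswer I.answer = I.table.answer := by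
  unfold answer Table.answer
  split
  · exact congrArg (Sym.yes :: ·) (congrArg₂ (· ++ ·) (encodeMatrix_eq I.table.fst)
      (encodeMatrix_eq I.table.snd))
  · rfl

theorem toReal_diffDiff (i j : Fin I.m) (k l : Fin I.n) :
    (I.table.diffDiff i j k l).toReal =
      deltaDelta ⟨0, I.m_pos⟩ ⟨0, I.n_pos⟩ I.cost i j k l := by
  have h : ∀ (i j : Fin I.m) (k l : Fin I.n), (I.table.diff i j k l).toReal =
      delta ⟨0, I.m_pos⟩ (fun i j => I.cost i j k l) i j := by
    intro i j k l
    -- The algorithm uses the numeral `0` as an index, so the instances at the base point are stated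
    -- separately and reduced to that form.
    have h0 := I.table_get ⟨0, I.m_pos⟩ ⟨0, I.m_pos⟩ k l
    have h1 := I.table_get ⟨0, I.m_pos⟩ j k l
    have h2 := I.table_get i ⟨0, I.m_pos⟩ k l
    dsimp only at h0 h1 h2
    simp only [Table.diff, Fraction.toReal_sub, Fraction.toReal_add, I.table_get, h0, h1, h2, delta,
      cost]
  have h0 := h i j ⟨0, I.n_pos⟩ ⟨0, I.n_pos⟩
  have h1 := h i j ⟨0, I.n_pos⟩ l
  have h2 := h i j k ⟨0, I.n_pos⟩
  dsimp only at h0 h1 h2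
  simp only [Table.diffDiff, Fraction.toReal_sub, Fraction.toReal_add, h, h0, h1, h2, deltaDelta]
  rfl

theorem test_iff : I.table.test = true ↔
    ∀ i j k l, deltaDelta ⟨0, I.m_pos⟩ ⟨0, I.n_pos⟩ I.cost i j k l = 0 := by
  simp only [Table.test, List.all_eq_true, List.mem_range, decide_eq_true_eq,
    ← Fraction.toReal_eq_zero, ← toReal_diffDiff]
  exact ⟨fun h i j k l => h i i.isLt j j.isLt k k.isLt l l.isLt,
    fun h i hi j hj k hk l hl => h ⟨i, hi⟩ ⟨j, hj⟩ ⟨k, hk⟩ ⟨l, hl⟩⟩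

theorem sum_range_toReal {s : ℕ} (g : ℕ → Fraction) :
    (Fraction.sum ((List.range s).map g)).toReal = ∑ i : Fin s, (g i).toReal := by
  rw [Fraction.toReal_sum, ← List.map_coe_finRange_eq_range, List.map_map, List.map_map,
    ← List.ofFn_eq_map, List.sum_ofFn]
  rfl

theorem isLinearization_of_test (h : I.table.test = true) :
    IsLinearization I.cost (Matrix.map (fun i j : Fin I.m => I.table.fst i j) Fraction.toReal)
      (Matrix.map (fun k l : Fin I.n => I.table.snd k l) Fraction.toReal) := by
  have hA : Matrix.map (fun i j : Fin I.m => I.table.fst i j) Fraction.toReal =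
      fun i j => ∑ k, I.cost i j k k := by
    ext i j
    exact (sum_range_toReal _).trans
      (Finset.sum_congr rfl fun k _ => congrArg Fraction.toReal (I.table_get i j k k))
  have hB : Matrix.map (fun k l : Fin I.n => I.table.snd k l) Fraction.toReal =
      fun k l => ∑ i, (I.cost i i k l - I.cost i i k k) := by
    ext k l
    refine (sum_range_toReal _).trans (Finset.sum_congr rfl fun i _ => ?_)
    rw [Fraction.toReal_sub, I.table_get i i k l, I.table_get i i k k]
    rfl
  rw [hA, hB]
  exact isLinearization_of_deltaDelta_eq_zero (I.test_iff.1 h)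

end Input

end BAP

/-- There is an algorithm `f`, carried out by a Turing machine in time polynomial in the length of
the binary encoding of the cost array, that answers "no" exactly on the cost arrays that are not
linearizable, and whose answer on a linearizable cost array is a linearization of it. -/
theorem mainTheorem12 :
    ∃ f : (I : BAP.Input) → BAP.Answer I.m I.n,
      Nonempty (Turing.TM2ComputableInPolyTime BAP.encodeInput (fun w : List BAP.Sym => w)
        (fun I : BAP.Input => BAP.encodeAnswer (f I))) ∧
      ∀ I : BAP.Input,
        (f I = none ↔ ¬ BAP.Linearizable I.cost) ∧
        ∀ (A : Matrix (Fin I.m) (Fin I.m) BAP.Fraction)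
          (B : Matrix (Fin I.n) (Fin I.n) BAP.Fraction),
          f I = some (A, B) →
            BAP.IsLinearization I.cost (A.map BAP.Fraction.toReal) (B.map BAP.Fraction.toReal) := by
  refine ⟨BAP.Input.answer, ?_, fun I => ⟨?_, fun A B h => ?_⟩⟩
  · refine BAP.PolyTime.tm2ComputableInPolyTime
      (BAP.PolyTime.table_answer (BAP.PolyTime.parseInput BAP.PolyTime.id)) fun I => ?_
    rw [BAP.parseInput_encodeInput, BAP.Input.encodeAnswer_answer]
    rfl
  · rw [← not_iff_not, not_not]
    constructor
    · intro h
      have ht : I.table.test = true := by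
        by_contra hn
        exact h (if_neg hn)
      exact ⟨_, _, I.isLinearization_of_test ht⟩
    · intro h hn
      -- Completeness: on a linearizable array the test cannot fail, so the answer is not "no".
      have ht := I.test_iff.2 fun i j k l => h.deltaDelta_eq_zero _ _ i j k l
      rw [BAP.Input.answer, if_pos ht] at hn
      exact Option.some_ne_none _ hn
  · unfold BAP.Input.answer at h
    split at h
    · next ht =>
      cases h
      exact I.isLinearization_of_test ht
    · cases h
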